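/- Let $T>0$, $I=(0,T)$, $d\in\mathbb{N}$. Let $\mathcal{M}(I;\mathbb{R}^d)$ be the space of regular $\mathbb{R}^d$-valued measures on $I$, i.e. the dual of $\mathcal{C}_0(I;\mathbb{R}^d)$ with the supremum norm $\|\cdot\|_{\mathcal C}$, equipped with the dual norm $\|\cdot\|_{\mathcal M}$, and let $\operatorname{BV}(I;\mathbb{R}^d)$ be the set of $u\in L^1(I;\mathbb{R}^d)$ whose distributional derivative $u'$ belongs to $\mathcal{M}(I;\mathbb{R}^d)$, i.e. $\int_I (u,\varphi')\,\mathrm{d}s=-\langle\varphi,u'\rangle$ for all $\varphi\in \mathcal{C}_c^\infty(I;\mathbb{R}^d)$, with norm $\|u\|_{\operatorname{BV}}=\|u'\|_{\mathcal M}+\|u\|_{L^1}$; recall $\operatorname{BV}(I;\mathbb{R}^d)\subset L^2(I;\mathbb{R}^d)$. Let $Y$ be a real Hilbert space, $K\colon L^2(I;\mathbb{R}^d)\to Y$ linear and continuous, $F\colon Y\to\mathbb{R}$ strictly convex and continuously Fréchet differentiable with gradient $\nabla F$, and $\beta>0$. Assume that $$ j(u)=F(Ku)+\beta\|u'\|_{\mathcal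 M},\qquad u\in\operatorname{BV}(I;\mathbb{R}^d), $$ is radially unbounded: $\|u_k\|_{\operatorname{BV}}\to\infty$ implies $j(u_k)\to+\infty$. Write $\chi_t$ for the characteristic function of $(t,T)$, $e_1,\dots,e_d$ for the canonical basis of $\mathbb{R}^d$, $\delta_t$ for the Dirac measure at $t$, and $a_u=\frac1T\int_I u(s)\,\mathrm{d}s$. Then $j$ has a minimizer over $\operatorname{BV}(I;\mathbb{R}^d)$. Let $\bar u$ be a minimizer and put $\bar p(t)=\int_0^t K^*\nabla F(K\bar u)(s)\,\mathrm{d}s$. Suppose that for some integer $N\ge 0$ and $\bar t_1,\dots,\bar t_N\in I$ $$\{\bar t_i\}_{i=1}^N=\{\,t\in I : |\bar p(t)|_{\mathbb{R}^d}=\|\bar p\|_{\mathcal C}=\beta\,\},$$ and that the family $\{K(\bar p(\bar t_i)\chi_{\bar t_i})\}_{i=1}^N\cup\{K(e_l\chi_I)\}_{l=1}^d$ is linearly independent in $Y$. Then $\bar u$ is the only minimizer of $j$, and there are $\bar\mu_1,\dots,\bar\mu_N\ge 0$ with $$\bar u'=\sum_{i=1}^N\bar\mu_i\,\frac{\bar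 p(\bar t_i)}{\beta}\,\delta_{\bar t_i};$$ in particular $\bar u$ is piecewise constant, namely $$\bar u(s)=a_{\bar u}+\sum_{i=1}^N\bar\mu_i\,\frac{\bar p(\bar t_i)}{\beta}\Bigl(\chi_{\bar t_i}(s)-\frac{T-\bar t_i}{T}\Bigr)\quad\text{for a.e. } s\in I.$$ -/

import Mathlib

open MeasureTheory Set Filter Topology
open scoped ZeroAtInfty ContDiff RealInnerProductSpace Gradient

noncomputable section

namespace BVJump

/-- `ℝ^d` with the Euclidean norm. -/
abbrev Vec (d : ℕ) : Type := EuclideanSpace ℝ (Fin d)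

/-- Lebesgue measure on the interval `I = (0, T)`. -/
abbrev leb (T : ℝ) : Measure ℝ := volume.restrict (Ioo 0 T)

/-- The Banach space `C₀(I; ℝ^d)` with the supremum norm. -/
abbrev C0 (T : ℝ) (d : ℕ) : Type := C₀(Ioo (0 : ℝ) T, Vec d)

/-- The space `M(I; ℝ^d)` of regular vector measures on `I`, as the topological dual of
`C₀(I; ℝ^d)`, with the dual norm; the duality pairing is evaluation. -/
abbrev Meas (T : ℝ) (d : ℕ) : Type := StrongDual ℝ (C0 T d)

/-- The vector measure `v δ_s`, that is `φ ↦ (φ(s), v)`. -/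
def dirac {T : ℝ} {d : ℕ} (s : Ioo (0 : ℝ) T) (v : Vec d) : Meas T d :=
  LinearMap.mkContinuous
    { toFun := fun φ => ⟪φ s, v⟫
      map_add' := fun φ ψ => by simp [inner_add_left]
      map_smul' := fun c φ => by simp [inner_smul_left] }
    ‖v‖
    (fun φ => by
      have h1 : ‖φ s‖ ≤ ‖φ‖ := φ.toBCF.norm_coe_le_norm s
      have h2 := norm_inner_le_norm (𝕜 := ℝ) (φ s) v
      have h3 := mul_le_mul_of_nonneg_right h1 (norm_nonneg v)
      calc ‖⟪φ s, v⟫‖ ≤ ‖φ s‖ * ‖v‖ := h2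
        _ ≤ ‖v‖ * ‖φ‖ := by linarith)

@[simp] theorem dirac_apply {T : ℝ} {d : ℕ} (s : Ioo (0 : ℝ) T) (v : Vec d) (φ : C0 T d) :
    dirac s v φ = ⟪φ s, v⟫ := rfl

/-- The test functions `C_c^∞(I; ℝ^d)`, extended by zero to `ℝ`. -/
def testSpace (T : ℝ) (d : ℕ) : Submodule ℝ (ℝ → Vec d) where
  carrier := {φ | ContDiff ℝ ∞ φ ∧ HasCompactSupport φ ∧ tsupport φ ⊆ Ioo 0 T}
  add_mem' := fun {a b} ha hb => ⟨ha.1.add hb.1, ha.2.1.add hb.2.1,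
    (tsupport_add a b).trans (union_subset ha.2.2 hb.2.2)⟩
  zero_mem' := ⟨contDiff_const, HasCompactSupport.zero, by simp [tsupport]⟩
  smul_mem' := fun c φ h => ⟨h.1.const_smul c, h.2.1.smul_left (f := fun _ => c),
    (closure_mono (Function.support_const_smul_subset c φ)).trans h.2.2⟩

/-- The type of test functions. -/
abbrev Test (T : ℝ) (d : ℕ) : Type := testSpace T d

/-- A test function, restricted to `I`, as an element of `C₀(I; ℝ^d)`. -/
def Test.toC0 {T : ℝ} {d : ℕ} (φ : Test T d) : C0 T d where
  toFun := fun s => φ.1 s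
  continuous_toFun := φ.2.1.continuous.comp continuous_subtype_val
  zero_at_infty' := by
    have hK : IsCompact (((↑) : Ioo (0 : ℝ) T → ℝ) ⁻¹' tsupport φ.1) :=
      Topology.IsInducing.subtypeVal.isCompact_preimage' φ.2.2.1
        (by rw [Subtype.range_coe]; exact φ.2.2.2)
    refine tendsto_const_nhds.congr' ?_
    filter_upwards [hK.compl_mem_cocompact] with s hs
    exact (image_eq_zero_of_notMem_tsupport hs).symm

@[simp] theorem Test.toC0_apply {T : ℝ} {d : ℕ} (φ : Test T d) (s : Ioo (0 : ℝ) T) :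
    φ.toC0 s = φ.1 s := rfl

/-- `q` is the distributional derivative of `u` on `I`. -/
def IsDistribDeriv {T : ℝ} {d : ℕ} (u : ℝ → Vec d) (q : Meas T d) : Prop :=
  ∀ φ : Test T d, ∫ s in Ioo 0 T, ⟪u s, deriv φ.1 s⟫ = -q φ.toC0

/-- The space `BV(I; ℝ^d)`: the classes `u ∈ L¹(I; ℝ^d)` whose distributional derivative is
represented by an element of `M(I; ℝ^d)`. -/
def BV (T : ℝ) (d : ℕ) : Type :=
  {u : Lp (Vec d) 1 (leb T) // ∃ q : Meas T d, IsDistribDeriv u q}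

theorem Test.exists_Icc {T : ℝ} {d : ℕ} (hT : 0 < T) (ψ : Test T d) :
    ∃ a b : ℝ, 0 < a ∧ b < T ∧ a ≤ b ∧ tsupport ψ.1 ⊆ Icc a b := by
  rcases (tsupport ψ.1).eq_empty_or_nonempty with h | h
  · exact ⟨T / 2, T / 2, by linarith, by linarith, le_rfl, by simp [h]⟩
  · obtain ⟨a, ha⟩ := (show IsCompact (tsupport ψ.1) from ψ.2.2.1).exists_isLeast h
    obtain ⟨b, hb⟩ := (show IsCompact (tsupport ψ.1) from ψ.2.2.1).exists_isGreatest h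
    exact ⟨a, b, (ψ.2.2.2 ha.1).1, (ψ.2.2.2 hb.1).2, ha.2 hb.1,
      fun x hx => ⟨ha.2 hx, hb.2 hx⟩⟩

theorem Test.integrable {T : ℝ} {d : ℕ} (ψ : Test T d) : Integrable ψ.1 :=
  ψ.2.1.continuous.integrable_of_hasCompactSupport ψ.2.2.1

theorem Test.setIntegral {T : ℝ} {d : ℕ} (ψ : Test T d) :
    ∫ s in Ioo 0 T, ψ.1 s = ∫ s, ψ.1 s :=
  setIntegral_eq_integral_of_forall_compl_eq_zero fun _ hs =>
    image_eq_zero_of_notMem_tsupport fun h => hs (ψ.2.2.2 h)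

/-- A test function with vanishing integral is the derivative of a test function. -/
theorem Test.exists_primitive {T : ℝ} {d : ℕ} (hT : 0 < T) (ψ : Test T d)
    (h0 : ∫ s, ψ.1 s = 0) :
    ∃ Φ : Test T d, deriv Φ.1 = ψ.1 ∧ ‖Φ.toC0‖ ≤ ∫ s, ‖ψ.1 s‖ := by
  obtain ⟨a, b, ha, hb, hab, hs⟩ := ψ.exists_Icc hT
  have hc : Continuous ψ.1 := ψ.2.1.continuous
  have hz : ∀ x, x ∉ Icc a b → ψ.1 x = 0 := fun x hx =>
    image_eq_zero_of_notMem_tsupport fun h => hx (hs h)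
  have hd : ∀ x, HasDerivAt (fun t => ∫ s in a..t, ψ.1 s) (ψ.1 x) x := fun x =>
    intervalIntegral.integral_hasDerivAt_right (hc.intervalIntegrable _ _)
      (hc.stronglyMeasurableAtFilter _ _) hc.continuousAt
  have hderiv : deriv (fun t => ∫ s in a..t, ψ.1 s) = ψ.1 := funext fun x => (hd x).deriv
  have hsm : ContDiff ℝ ∞ (fun t => ∫ s in a..t, ψ.1 s) := by
    rw [contDiff_infty_iff_deriv]
    exact ⟨fun x => (hd x).differentiableAt, by rw [hderiv]; exact ψ.2.1⟩
  have hzero : ∀ x, x ∉ Icc a b → ∫ s in a..x, ψ.1 s = 0 := by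
    intro x hx
    rcases lt_or_ge x a with h | h
    · rw [intervalIntegral.integral_symm, intervalIntegral.integral_of_le h.le,
        integral_Ioc_eq_integral_Ioo, setIntegral_eq_zero_of_forall_eq_zero, neg_zero]
      exact fun y hy => hz y fun h' => absurd h'.1 (not_le.2 hy.2)
    · have hbx : b < x := not_le.1 fun h' => hx ⟨h, h'⟩
      rw [intervalIntegral.integral_of_le h, ← integral_Icc_eq_integral_Ioc,
        setIntegral_eq_integral_of_forall_compl_eq_zero, h0]
      exact fun y hy => hz y fun h' => hy ⟨h'.1, h'.2.trans hbx.le⟩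
  have hsupp : tsupport (fun t => ∫ s in a..t, ψ.1 s) ⊆ Icc a b :=
    closure_minimal (fun x hx => by by_contra h; exact hx (hzero x h)) isClosed_Icc
  refine ⟨⟨fun t => ∫ s in a..t, ψ.1 s, hsm, ?_, ?_⟩, hderiv, ?_⟩
  · exact isCompact_Icc.of_isClosed_subset (isClosed_tsupport _) hsupp
  · exact hsupp.trans fun x hx => ⟨ha.trans_le hx.1, hx.2.trans_lt hb⟩
  · rw [← ZeroAtInftyContinuousMap.norm_toBCF_eq_norm]
    refine (BoundedContinuousFunction.norm_le (integral_nonneg fun _ => norm_nonneg _)).2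
      fun s => ?_
    change ‖∫ x in a..(s : ℝ), ψ.1 x‖ ≤ _
    refine intervalIntegral.norm_integral_le_integral_norm_uIoc.trans ?_
    exact setIntegral_le_integral ψ.integrable.norm (ae_of_all _ fun _ => norm_nonneg _)

theorem exists_bump {T : ℝ} (hT : 0 < T) : ∃ η : ℝ → ℝ, ContDiff ℝ ∞ η ∧ HasCompactSupport η ∧
    tsupport η ⊆ Ioo 0 T ∧ ∫ s, η s = 1 := by
  obtain ⟨f, hf, hc, hsm, hr, h1⟩ := exists_contDiff_tsupport_subset (E := ℝ) (n := ⊤)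
    (Ioo_mem_nhds (show 0 < T / 2 by linarith) (show T / 2 < T by linarith))
  have hnn : ∀ x, 0 ≤ f x := fun x => (hr ⟨x, rfl⟩).1
  have hpos : 0 < ∫ s, f s := by
    refine hsm.continuous.integral_pos_of_hasCompactSupport_nonneg_nonzero hc hnn
      (x := T / 2) (by rw [h1]; norm_num)
  refine ⟨fun s => (∫ s, f s)⁻¹ * f s, contDiff_const.mul hsm, hc.mul_left, ?_, ?_⟩
  · exact (closure_mono (Function.support_const_smul_subset (∫ s, f s)⁻¹ f)).trans hf
  · rw [integral_const_mul, inv_mul_cancel₀ hpos.ne']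

theorem Test.integrable_inner {T : ℝ} {d : ℕ} {u : ℝ → Vec d} (hu : Integrable u (leb T))
    (ψ : Test T d) : Integrable (fun s => ⟪u s, ψ.1 s⟫) (leb T) := by
  obtain ⟨C, hC⟩ := ψ.2.2.1.exists_bound_of_continuous ψ.2.1.continuous
  refine (hu.norm.mul_const C).mono'
    (hu.aestronglyMeasurable.inner ψ.2.1.continuous.aestronglyMeasurable)
    (ae_of_all _ fun s => ?_)
  exact (norm_inner_le_norm _ _).trans (mul_le_mul_of_nonneg_left (hC s) (norm_nonneg _))

theorem exists_bound {T : ℝ} {d : ℕ} (hT : 0 < T) {u : ℝ → Vec d} (hu : Integrable u (leb T))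
    {q : Meas T d} (hq : IsDistribDeriv u q) :
    ∃ C : ℝ, 0 ≤ C ∧ ∀ ψ : Test T d, |∫ s in Ioo 0 T, ⟪u s, ψ.1 s⟫| ≤ C * ∫ s, ‖ψ.1 s‖ := by
  obtain ⟨η, hη, hηc, hηs, hη1⟩ := exists_bump hT
  have hηi : Integrable η := hη.continuous.integrable_of_hasCompactSupport hηc
  obtain ⟨M, hM⟩ := hηc.exists_bound_of_continuous hη.continuous
  have hM0 : 0 ≤ M := (norm_nonneg _).trans (hM 0)
  set A := ∫ s, ‖η s‖ with hA
  have hA0 : 0 ≤ A := integral_nonneg fun _ => norm_nonneg _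
  set U := ∫ s in Ioo 0 T, ‖u s‖ with hU
  have hU0 : 0 ≤ U := integral_nonneg fun _ => norm_nonneg _
  refine ⟨‖q‖ * (1 + A) + M * U, by positivity, fun ψ => ?_⟩
  set m := ∫ s, ψ.1 s with hm
  set L := ∫ s, ‖ψ.1 s‖ with hL
  have hmL : ‖m‖ ≤ L := norm_integral_le_integral_norm _
  let E : Test T d := ⟨fun s => η s • m, hη.smul contDiff_const, hηc.smul_right,
    (tsupport_smul_subset_left η _).trans hηs⟩
  have hE : ∫ s, E.1 s = m := by
    change ∫ s, η s • m = m
    rw [integral_smul_const, hη1, one_smul]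
  have h0 : ∫ s, (ψ - E).1 s = 0 := by
    change ∫ s, (ψ.1 s - E.1 s) = 0
    rw [integral_sub ψ.integrable E.integrable, hE, sub_self]
  obtain ⟨Φ, hΦ, hΦn⟩ := (ψ - E).exists_primitive hT h0
  have hnorm : ∫ s, ‖(ψ - E).1 s‖ ≤ (1 + A) * L := by
    calc ∫ s, ‖(ψ - E).1 s‖ ≤ ∫ s, (‖ψ.1 s‖ + ‖η s‖ * ‖m‖) := by
          refine integral_mono (ψ - E).integrable.norm
            (ψ.integrable.norm.add (hηi.norm.mul_const _)) fun s => ?_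
          change ‖ψ.1 s - η s • m‖ ≤ _
          exact (norm_sub_le _ _).trans (by rw [norm_smul])
      _ = L + A * ‖m‖ := by
          rw [integral_add ψ.integrable.norm (hηi.norm.mul_const _), integral_mul_const]
      _ ≤ (1 + A) * L := by nlinarith
  have hsplit : ∫ s in Ioo 0 T, ⟪u s, ψ.1 s⟫
      = -q Φ.toC0 + ∫ s in Ioo 0 T, ⟪u s, E.1 s⟫ := by
    rw [← hq Φ, hΦ, ← integral_add ((ψ - E).integrable_inner hu) (E.integrable_inner hu)]
    refine integral_congr_ae (ae_of_all _ fun s => ?_)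
    change ⟪u s, ψ.1 s⟫ = ⟪u s, ψ.1 s - E.1 s⟫ + ⟪u s, E.1 s⟫
    rw [← inner_add_right, sub_add_cancel]
  have h1 : |q Φ.toC0| ≤ ‖q‖ * ((1 + A) * L) :=
    (q.le_opNorm _).trans (mul_le_mul_of_nonneg_left (hΦn.trans hnorm) (norm_nonneg _))
  have h2 : |∫ s in Ioo 0 T, ⟪u s, E.1 s⟫| ≤ M * U * L := by
    calc |∫ s in Ioo 0 T, ⟪u s, E.1 s⟫| ≤ ∫ s in Ioo 0 T, ‖u s‖ * (M * L) := by
          rw [← Real.norm_eq_abs]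
          refine norm_integral_le_of_norm_le (hu.norm.mul_const (M * L))
            (ae_of_all _ fun s => ?_)
          change ‖⟪u s, η s • m⟫‖ ≤ _
          refine (norm_inner_le_norm (𝕜 := ℝ) _ _).trans
            (mul_le_mul_of_nonneg_left ?_ (norm_nonneg _))
          rw [norm_smul]
          exact mul_le_mul (hM s) hmL (norm_nonneg _) hM0
      _ = M * U * L := by rw [integral_mul_const]; ring
  rw [hsplit]
  refine (abs_add_le _ _).trans ?_
  rw [abs_neg]
  linarith

/-- Functions of bounded variation on `I` are square integrable. -/
theorem memLp_two {T : ℝ} {d : ℕ} {u : ℝ → Vec d} (hu : Integrable u (leb T))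
    {q : Meas T d} (hq : IsDistribDeriv u q) : MemLp u 2 (leb T) := by
  rcases le_or_gt T 0 with hT | hT
  · simp [leb, Ioo_eq_empty (not_lt.2 hT)]
  obtain ⟨C, hC0, hC⟩ := exists_bound hT hu hq
  have hmem : ∀ ψ : Test T d, MemLp ψ.1 2 (leb T) := fun ψ =>
    (ψ.2.1.continuous.memLp_of_hasCompactSupport ψ.2.2.1).restrict _
  let J : Test T d →ₗ[ℝ] Lp (Vec d) 2 (leb T) :=
    { toFun := fun ψ => (hmem ψ).toLp ψ.1
      map_add' := fun a b => MemLp.toLp_add (hmem a) (hmem b)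
      map_smul' := fun c a => MemLp.toLp_const_smul c (hmem a) }
  let ℓ : Test T d →ₗ[ℝ] ℝ :=
    { toFun := fun ψ => ∫ s in Ioo 0 T, ⟪u s, ψ.1 s⟫
      map_add' := fun a b => by
        rw [← integral_add (a.integrable_inner hu) (b.integrable_inner hu)]
        exact integral_congr_ae (ae_of_all _ fun s => inner_add_right _ _ _)
      map_smul' := fun c a => by
        rw [RingHom.id_apply, smul_eq_mul, ← integral_const_mul]
        exact integral_congr_ae (ae_of_all _ fun s => inner_smul_right _ _ _) }
  obtain ⟨D, hD⟩ : ∃ D : ℝ, ∀ ψ, |ℓ ψ| ≤ D * ‖J ψ‖ := by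
    refine ⟨C * ((leb T univ) ^ (1 / (1 : ENNReal).toReal - 1 / (2 : ENNReal).toReal)).toReal,
      fun ψ => (hC ψ).trans ?_⟩
    rw [mul_assoc]
    refine mul_le_mul_of_nonneg_left ?_ hC0
    have h1 := eLpNorm_le_eLpNorm_mul_rpow_measure_univ (μ := leb T) (p := 1) (q := 2)
      (by norm_num) (hmem ψ).1
    have h2 : ∫ s, ‖ψ.1 s‖ = (eLpNorm ψ.1 1 (leb T)).toReal := by
      rw [eLpNorm_one_eq_lintegral_enorm, ← integral_norm_eq_lintegral_enorm (hmem ψ).1]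
      refine (setIntegral_eq_integral_of_forall_compl_eq_zero fun s hs => ?_).symm
      rw [image_eq_zero_of_notMem_tsupport fun h => hs (ψ.2.2.2 h), norm_zero]
    have h3 : ‖J ψ‖ = (eLpNorm ψ.1 2 (leb T)).toReal :=
      Lp.norm_toLp ψ.1 (hmem ψ)
    rw [h2, h3, mul_comm, ← ENNReal.toReal_mul]
    refine ENNReal.toReal_mono (ENNReal.mul_ne_top (hmem ψ).2.ne ?_) h1
    exact (ENNReal.rpow_lt_top_of_nonneg (by norm_num) (measure_ne_top _ _)).ne
  have hker : LinearMap.ker J ≤ LinearMap.ker ℓ := fun ψ hψ => by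
    have h := hD ψ
    rw [LinearMap.mem_ker.1 hψ, norm_zero, mul_zero] at h
    exact LinearMap.mem_ker.2 (abs_eq_zero.1 (le_antisymm h (abs_nonneg _)))
  let g : LinearMap.range J →ₗ[ℝ] ℝ :=
    ((LinearMap.ker J).liftQ ℓ hker).comp J.quotKerEquivRange.symm.toLinearMap
  have hg : ∀ ψ : Test T d, g ⟨J ψ, ψ, rfl⟩ = ℓ ψ := fun ψ => by
    have : J.quotKerEquivRange.symm ⟨J ψ, ψ, rfl⟩ = (LinearMap.ker J).mkQ ψ := by
      rw [LinearEquiv.symm_apply_eq]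
      rfl
    change (LinearMap.ker J).liftQ ℓ hker (J.quotKerEquivRange.symm ⟨J ψ, ψ, rfl⟩) = ℓ ψ
    rw [this]
    rfl
  let G : StrongDual ℝ (LinearMap.range J) := g.mkContinuous D (by
    rintro ⟨_, ψ, rfl⟩
    rw [hg]
    exact hD ψ)
  obtain ⟨H, hH, -⟩ := exists_extension_norm_eq (LinearMap.range J) G
  set v := (InnerProductSpace.toDual ℝ (Lp (Vec d) 2 (leb T))).symm H with hv
  have hvi : Integrable v (leb T) := (Lp.memLp v).integrable (by norm_num)
  have key : ∀ ψ : Test T d, ∫ s in Ioo 0 T, ⟪v s - u s, ψ.1 s⟫ = 0 := fun ψ => by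
    have h1 : H (J ψ) = ℓ ψ := (hH ⟨J ψ, ψ, rfl⟩).trans (hg ψ)
    have h2 : H (J ψ) = ∫ s in Ioo 0 T, ⟪v s, ψ.1 s⟫ := by
      rw [← InnerProductSpace.toDual_symm_apply (𝕜 := ℝ) (x := J ψ) (y := H), L2.inner_def]
      refine integral_congr_ae ?_
      filter_upwards [(hmem ψ).coeFn_toLp] with s hs
      change ⟪v s, (J ψ : ℝ → Vec d) s⟫ = _
      rw [show (J ψ : ℝ → Vec d) s = ψ.1 s from hs]
    have h3 : ∫ s in Ioo 0 T, ⟪v s - u s, ψ.1 s⟫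
        = (∫ s in Ioo 0 T, ⟪v s, ψ.1 s⟫) - ∫ s in Ioo 0 T, ⟪u s, ψ.1 s⟫ := by
      rw [← integral_sub (ψ.integrable_inner hvi) (ψ.integrable_inner hu)]
      exact integral_congr_ae (ae_of_all _ fun s => inner_sub_left _ _ _)
    rw [h3, ← h2, h1]
    exact sub_self _
  have hae : ∀ᵐ s ∂(volume : Measure ℝ), s ∈ Ioo 0 T → v s - u s = 0 := by
    refine isOpen_Ioo.ae_eq_zero_of_integral_contDiff_smul_eq_zero
      (IntegrableOn.locallyIntegrableOn (hvi.sub hu)) fun γ hγ hγc hγs => ?_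
    have hres : ∫ s, γ s • (v s - u s) = ∫ s in Ioo 0 T, γ s • (v s - u s) :=
      (setIntegral_eq_integral_of_forall_compl_eq_zero fun s hs => by
        rw [image_eq_zero_of_notMem_tsupport fun h => hs (hγs h), zero_smul]).symm
    obtain ⟨M, hM⟩ := hγc.exists_bound_of_continuous hγ.continuous
    have hint : Integrable (fun s => γ s • (v s - u s)) (leb T) :=
      (hvi.sub hu).bdd_smul M hγ.continuous.aestronglyMeasurable (ae_of_all _ hM)
    rw [hres]
    refine ext_inner_left ℝ fun e => ?_
    rw [inner_zero_right, ← integral_inner hint e,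
      ← key ⟨fun s => γ s • e, hγ.smul contDiff_const, hγc.smul_right,
        (tsupport_smul_subset_left γ _).trans hγs⟩]
    refine integral_congr_ae (ae_of_all _ fun s => ?_)
    change ⟪e, γ s • (v s - u s)⟫ = ⟪v s - u s, γ s • e⟫
    rw [inner_smul_right, inner_smul_right, real_inner_comm]
  refine (memLp_congr_ae ?_).1 (Lp.memLp v)
  filter_upwards [(ae_restrict_iff' measurableSet_Ioo).2 hae] with s hs
  exact sub_eq_zero.1 hs

namespace BV

variable {T : ℝ} {d : ℕ}

/-- The distributional derivative `u' ∈ M(I; ℝ^d)`; it is unique because the test functions are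
dense in `C₀(I; ℝ^d)`. -/
def deriv (u : BV T d) : Meas T d := u.2.choose

theorem isDistribDeriv (u : BV T d) : IsDistribDeriv u.1 u.deriv := u.2.choose_spec

/-- The BV norm `‖u'‖_M + ‖u‖_{L¹}`. -/
def norm (u : BV T d) : ℝ := ‖u.deriv‖ + ‖u.1‖

/-- The vector `a_u` of mean values. -/
def mean (u : BV T d) : Vec d := T⁻¹ • ∫ s in Ioo 0 T, u.1 s

/-- The embedding of `BV(I; ℝ^d)` into `L²(I; ℝ^d)`. -/
def toL2 (u : BV T d) : Lp (Vec d) 2 (leb T) :=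
  (memLp_two (L1.integrable_coeFn u.1) u.isDistribDeriv).toLp u.1

end BV

section Problem

variable {T : ℝ} {d : ℕ} {Y : Type*} [NormedAddCommGroup Y] [InnerProductSpace ℝ Y]

/-- The objective functional `j(u) = F(Ku) + β ‖u'‖_M`. -/
def objective (K : Lp (Vec d) 2 (leb T) →L[ℝ] Y) (F : Y → ℝ) (β : ℝ) (u : BV T d) : ℝ :=
  F (K u.toL2) + β * ‖u.deriv‖

/-- Radial unboundedness of `j` with respect to the BV norm. -/
def RadiallyUnbounded (K : Lp (Vec d) 2 (leb T) →L[ℝ] Y) (F : Y → ℝ) (β : ℝ) : Prop :=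
  ∀ u : ℕ → BV T d, Tendsto (fun k => (u k).norm) atTop atTop →
    Tendsto (fun k => objective K F β (u k)) atTop atTop

/-- `u` minimizes `j` over `BV(I; ℝ^d)`. -/
def IsMinimizer (K : Lp (Vec d) 2 (leb T) →L[ℝ] Y) (F : Y → ℝ) (β : ℝ) (u : BV T d) : Prop :=
  ∀ v : BV T d, objective K F β u ≤ objective K F β v

/-- The dual variable `p(t) = ∫₀ᵗ K* ∇F(Ku)(s) ds`. -/
def dualVar [CompleteSpace Y] (K : Lp (Vec d) 2 (leb T) →L[ℝ] Y) (F : Y → ℝ) (u : BV T d)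
    (t : ℝ) : Vec d :=
  ∫ s in (0 : ℝ)..t, (ContinuousLinearMap.adjoint K (∇ F (K u.toL2)) : ℝ → Vec d) s

/-- The supremum norm over `I`. -/
def supNorm (T : ℝ) (p : ℝ → Vec d) : ℝ := ⨆ s : Ioo (0 : ℝ) T, ‖p s‖

/-- The function `c χ_t`, with `χ_t` the characteristic function of `(t, T)`,
as an element of `L²(I; ℝ^d)`. -/
def stepL2 (T t : ℝ) (c : Vec d) : Lp (Vec d) 2 (leb T) :=
  indicatorConstLp 2 (measurableSet_Ioo (a := t) (b := T)) (measure_ne_top _ _) c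

end Problem

end BVJump

end

/-! Existence. Seen in `L²`, the sublevel sets of `j` are convex; closed, because total variation is
lower semicontinuous; and bounded, by radial unboundedness and the embedding
`BV.exists_norm_toL2_le`. Along a minimizing sequence they are nested, so they have a common point
(`nonempty_iInter_of_convex`), and this point is a minimizer.

Optimality. Let `g = K* ∇F(Ku)`. Differentiating along segments gives `0 ≤ ⟪w - u, g⟫ + β (‖w'‖ -
‖u'‖)` for every `w` in BV. Perturbing by constants forces `∫ g = 0`, so the primitive `p` of `g`
vanishes at both ends, lies in `C₀`, and satisfies `⟪w, g⟫ = -w'(p)` (`IsDistribDeriv.inner_eq`).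
The choices `w = 2u`, `w = 0` and `w = p(s) χ_s` then yield `u'(p) = β ‖u'‖` and `|p| ≤ β`
(`IsMinimizer.exists_dual`).

Structure. Thus `u'` attains its norm in the direction `p`. Such a functional kills every `φ` that
vanishes where `|p| = β`: moving `p` slightly by `±φ` away from this set does not leave the ball of
radius `β` (`apply_eq_zero_of_attains`). If the set is finite, `u'` is a sum of Dirac measures, and
equality in Cauchy-Schwarz aligns their vectors with `p` (`exists_sum_inner_of_attains`).
Integrating, `u` is a sum of steps plus a constant.

Uniqueness. Strict convexity of `F` makes `Ku`, hence `p`, the same for all minimizers. They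
therefore share jump points and directions, and linear independence determines amplitudes and
constant from `Ku`. -/

noncomputable section

namespace BVJump

/-! ### Soft thresholding of vectors -/

section SoftThreshold

variable {V : Type*} [NormedAddCommGroup V] [NormedSpace ℝ V]

/-- The soft thresholding map, which shortens a vector by `δ`. -/
def softThreshold (δ : ℝ) (y : V) : V := (1 - δ / max ‖y‖ δ) • y

theorem continuous_softThreshold {δ : ℝ} (hδ : 0 < δ) :
    Continuous (softThreshold δ : V → V) := by
  unfold softThreshold
  have h : ∀ y : V, max ‖y‖ δ ≠ 0 := fun y => (hδ.trans_le (le_max_right _ _)).ne'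
  fun_prop (disch := exact h _)

theorem softThreshold_of_norm_le {δ : ℝ} (hδ : 0 < δ) {y : V} (hy : ‖y‖ ≤ δ) :
    softThreshold δ y = 0 := by
  rw [softThreshold, max_eq_right hy, div_self hδ.ne', sub_self, zero_smul]

theorem norm_softThreshold_sub_le {δ : ℝ} (hδ : 0 < δ) (y : V) :
    ‖softThreshold δ y - y‖ ≤ δ := by
  have h : softThreshold δ y - y = -((δ / max ‖y‖ δ) • y) := by
    rw [softThreshold, sub_smul, one_smul]; abel
  have hm : 0 < max ‖y‖ δ := hδ.trans_le (le_max_right _ _)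
  rw [h, norm_neg, norm_smul, Real.norm_of_nonneg (by positivity), div_mul_eq_mul_div,
    div_le_iff₀ hm]
  exact mul_le_mul_of_nonneg_left (le_max_left _ _) hδ.le

theorem norm_softThreshold_le {δ : ℝ} (hδ : 0 < δ) (y : V) : ‖softThreshold δ y‖ ≤ ‖y‖ := by
  have hm : 0 < max ‖y‖ δ := hδ.trans_le (le_max_right _ _)
  have h1 : δ / max ‖y‖ δ ≤ 1 := (div_le_one hm).2 (le_max_right _ _)
  have h2 : 0 ≤ δ / max ‖y‖ δ := by positivity
  rw [softThreshold, norm_smul, Real.norm_of_nonneg (by linarith)]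
  exact mul_le_of_le_one_left (norm_nonneg _) (by linarith)

end SoftThreshold

/-! ### Functions vanishing at infinity -/

section ZeroAtInfty

variable {X : Type*} [TopologicalSpace X] {V : Type*} [NormedAddCommGroup V]

theorem norm_apply_le_norm (φ : C₀(X, V)) (x : X) : ‖φ x‖ ≤ ‖φ‖ :=
  φ.toBCF.norm_coe_le_norm x

theorem zeroAtInfty_norm_le {φ : C₀(X, V)} {C : ℝ} (hC : 0 ≤ C) (h : ∀ x, ‖φ x‖ ≤ C) :
    ‖φ‖ ≤ C := by
  rw [← ZeroAtInftyContinuousMap.norm_toBCF_eq_norm]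
  exact (BoundedContinuousFunction.norm_le hC).2 h

/-- Smallness at infinity confines this closed set to a compact one. It is what makes thresholded
functions compactly supported. -/
theorem isCompact_setOf_le_norm (φ : C₀(X, V)) {δ : ℝ} (hδ : 0 < δ) :
    IsCompact {x | δ ≤ ‖φ x‖} := by
  have h : ∀ᶠ x in cocompact X, ‖φ x‖ < δ := by
    have := (zero_at_infty φ).norm
    rw [norm_zero] at this
    exact this.eventually_lt_const hδ
  obtain ⟨s, hs, hsub⟩ := mem_cocompact.1 h
  refine hs.of_isClosed_subset (isClosed_le continuous_const (map_continuous φ).norm) ?_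
  intro x hx
  by_contra hxs
  exact absurd (show ‖φ x‖ < δ from hsub hxs) (not_lt.2 hx)

/-- Soft thresholding of a function vanishing at infinity. -/
def thresholdC0 [NormedSpace ℝ V] {δ : ℝ} (hδ : 0 < δ) (φ : C₀(X, V)) : C₀(X, V) where
  toFun := fun x => softThreshold δ (φ x)
  continuous_toFun := (continuous_softThreshold hδ).comp (map_continuous φ)
  zero_at_infty' := by
    have h := ((continuous_softThreshold (V := V) hδ).tendsto 0).comp (zero_at_infty φ)
    rwa [softThreshold_of_norm_le hδ (by rw [norm_zero]; exact hδ.le)] at h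

theorem thresholdC0_apply [NormedSpace ℝ V] {δ : ℝ} (hδ : 0 < δ) (φ : C₀(X, V)) (x : X) :
    thresholdC0 hδ φ x = softThreshold δ (φ x) := rfl

/-- The product of a scalar function of compact support and a continuous function. -/
def smulC0 [NormedSpace ℝ V] (χ : C(X, ℝ)) (hχ : HasCompactSupport χ) (f : C(X, V)) :
    C₀(X, V) where
  toFun := fun x => χ x • f x
  continuous_toFun := χ.continuous.smul f.continuous
  zero_at_infty' := by
    refine tendsto_const_nhds.congr' ?_
    filter_upwards [(show IsCompact (tsupport χ) from hχ).compl_mem_cocompact] with x hx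
    rw [image_eq_zero_of_notMem_tsupport hx, zero_smul]

theorem smulC0_apply [NormedSpace ℝ V] (χ : C(X, ℝ)) (hχ : HasCompactSupport χ) (f : C(X, V))
    (x : X) : smulC0 χ hχ f x = χ x • f x := rfl

end ZeroAtInfty

/-! ### Functionals that attain their norm -/

section Support

variable {X : Type*} [TopologicalSpace X] {V : Type*} [NormedAddCommGroup V]
  [InnerProductSpace ℝ V]

/-- A functional that attains its norm at `p` only sees the points where `‖p‖` is maximal. -/
theorem apply_eq_zero_of_attains {β : ℝ} (q : StrongDual ℝ C₀(X, V)) (p φ : C₀(X, V))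
    (hp : ∀ x, ‖p x‖ ≤ β) (hq : q p = β * ‖q‖) (hβ : 0 < β)
    (hφ : ∀ x, ‖p x‖ = β → φ x = 0) : q φ = 0 := by
  -- It suffices to treat the thresholded function `ψ`, which is within `δ` of `φ` and vanishes
  -- wherever `‖φ‖ ≤ δ`.
  have key : ∀ δ > 0, |q φ| ≤ ‖q‖ * δ := by
    intro δ hδ
    set ψ := thresholdC0 hδ φ with hψ
    have hd : ‖φ - ψ‖ ≤ δ := zeroAtInfty_norm_le hδ.le fun x => by
      rw [ZeroAtInftyContinuousMap.sub_apply, norm_sub_rev]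
      exact norm_softThreshold_sub_le hδ (φ x)
    have hψ0 : q ψ = 0 := by
      -- The compact set `{δ ≤ ‖φ‖}` misses the set where `‖p‖ = β`, so `‖p‖` stays below `β` there
      -- by a fixed margin.
      obtain ⟨γ, hγ, hγp⟩ : ∃ γ > 0, ∀ x, δ ≤ ‖φ x‖ → ‖p x‖ ≤ β - γ := by
        rcases {x | δ ≤ ‖φ x‖}.eq_empty_or_nonempty with he | hne
        · refine ⟨1, one_pos, fun x hx => ?_⟩
          have : x ∈ {x | δ ≤ ‖φ x‖} := hx
          simp [he] at this
        · obtain ⟨x₀, hx₀, hmax⟩ := (isCompact_setOf_le_norm φ hδ).exists_isMaxOn hne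
            (map_continuous p).norm.continuousOn
          refine ⟨β - ‖p x₀‖, ?_, fun x hx => by
            have : ‖p x‖ ≤ ‖p x₀‖ := hmax hx
            linarith⟩
          refine sub_pos.2 (lt_of_le_of_ne (hp x₀) fun h => ?_)
          have hx : δ ≤ ‖φ x₀‖ := hx₀
          rw [hφ x₀ h, norm_zero] at hx
          linarith
      -- For such `s`, of either sign, `p + s • ψ` stays in the ball of radius `β`, on which `q` is
      -- maximal at `p`.
      have hs : ∀ s : ℝ, |s| * ‖φ‖ ≤ γ → s * q ψ ≤ 0 := by
        intro s hs
        have h1 : ‖p + s • ψ‖ ≤ β := zeroAtInfty_norm_le hβ.le fun x => by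
          rw [ZeroAtInftyContinuousMap.add_apply, ZeroAtInftyContinuousMap.smul_apply]
          rcases le_or_gt δ ‖φ x‖ with hx | hx
          · refine (norm_add_le _ _).trans ?_
            have h2 : ‖s • ψ x‖ ≤ γ := by
              rw [norm_smul, Real.norm_eq_abs]
              exact (mul_le_mul_of_nonneg_left ((norm_softThreshold_le hδ _).trans
                (norm_apply_le_norm φ x)) (abs_nonneg s)).trans hs
            have := hγp x hx
            linarith
          · rw [hψ, thresholdC0_apply, softThreshold_of_norm_le hδ hx.le, smul_zero, add_zero]
            exact hp x
        have h2 : q (p + s • ψ) ≤ ‖q‖ * β := (le_abs_self _).trans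
          ((q.le_opNorm _).trans (mul_le_mul_of_nonneg_left h1 (norm_nonneg _)))
        rw [map_add, map_smul, smul_eq_mul, hq] at h2
        linarith
      have hpos : 0 < ‖φ‖ + 1 := by positivity
      have hb : |γ / (‖φ‖ + 1)| * ‖φ‖ ≤ γ := by
        rw [abs_of_pos (by positivity), div_mul_eq_mul_div, div_le_iff₀ hpos]
        nlinarith
      have h1 := hs (γ / (‖φ‖ + 1)) hb
      have h2 := hs (-(γ / (‖φ‖ + 1))) (by rwa [abs_neg])
      have hpos' : 0 < γ / (‖φ‖ + 1) := by positivity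
      nlinarith
    have h3 : q φ = q (φ - ψ) := by rw [map_sub, hψ0, sub_zero]
    rw [h3]
    exact (q.le_opNorm _).trans (mul_le_mul_of_nonneg_left hd (norm_nonneg _))
  have : |q φ| ≤ 0 := by
    refine le_of_forall_pos_le_add fun ε hε => ?_
    have h := key (ε / (‖q‖ + 1)) (by positivity)
    have h2 : ‖q‖ * (ε / (‖q‖ + 1)) ≤ ε := by
      rw [mul_div_assoc', div_le_iff₀ (by positivity)]
      nlinarith [norm_nonneg q]
    linarith
  exact abs_eq_zero.1 (le_antisymm this (abs_nonneg _))

/-- A functional that attains its norm at `p`, where `‖p‖` is maximal at finitely many points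
only, is a combination of Dirac functionals at these points in the directions of `p`. -/
theorem exists_sum_inner_of_attains [T2Space X] [LocallyCompactSpace X] [FiniteDimensional ℝ V]
    {ι : Type*} [Fintype ι] {β : ℝ} (hβ : 0 < β)
    (q : StrongDual ℝ C₀(X, V)) (p : C₀(X, V)) (hp : ∀ x, ‖p x‖ ≤ β) (hq : q p = β * ‖q‖)
    (t : ι → X) (ht : Function.Injective t) (htp : range t = {x | ‖p x‖ = β}) :
    ∃ m : ι → ℝ, (∀ i, 0 ≤ m i) ∧ ∀ φ, q φ = ∑ i, m i * ⟪φ (t i), β⁻¹ • p (t i)⟫ := by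
  classical
  -- Cutoffs dual to the points `t j`; they interpolate any function on the set where `‖p‖ = β`.
  have hχ : ∀ i, ∃ χ : C(X, ℝ), χ (t i) = 1 ∧ (∀ j, j ≠ i → χ (t j) = 0) ∧
      HasCompactSupport χ ∧ ∀ x, χ x ∈ Icc (0 : ℝ) 1 := fun i => by
    obtain ⟨χ, h1, h0, hc, hr⟩ := exists_continuous_one_zero_of_isCompact
      (isCompact_singleton (x := t i)) (t := t '' {j | j ≠ i})
      ((Set.toFinite _).isClosed) (by
        rw [Set.disjoint_singleton_left]
        rintro ⟨j, hj, hji⟩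
        exact hj (ht hji))
    exact ⟨χ, h1 rfl, fun j hj => h0 ⟨j, hj, rfl⟩, hc, hr⟩
  choose χ hχ1 hχ0 hχc hχr using hχ
  let L : ι → V →ₗ[ℝ] ℝ := fun i =>
    { toFun := fun v => q (smulC0 (χ i) (hχc i) (ContinuousMap.const X v))
      map_add' := fun v w => by
        rw [← map_add]
        congr 1
        ext x
        simp [smulC0_apply]
      map_smul' := fun c v => by
        rw [RingHom.id_apply, ← map_smul]
        congr 1
        ext x
        simp [smulC0_apply, smul_comm c] }
  set c : ι → V := fun i =>
    (InnerProductSpace.toDual ℝ V).symm (LinearMap.toContinuousLinearMap (L i)) with hc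
  have hcL : ∀ i v, q (smulC0 (χ i) (hχc i) (ContinuousMap.const X v)) = ⟪c i, v⟫ := fun i v => by
    rw [hc, InnerProductSpace.toDual_symm_apply]
    rfl
  have hmem : ∀ x, ‖p x‖ = β → ∃ i, t i = x := fun x hx => by
    have : x ∈ range t := by rw [htp]; exact hx
    exact this
  -- The difference of `φ` and its interpolant vanishes where `‖p‖ = β`, hence is killed by `q`.
  have hrep : ∀ φ, q φ = ∑ i, ⟪c i, φ (t i)⟫ := fun φ => by
    have h0 : q (φ - ∑ i, smulC0 (χ i) (hχc i) (ContinuousMap.const X (φ (t i)))) = 0 := by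
      refine apply_eq_zero_of_attains q p _ hp hq hβ fun x hx => ?_
      obtain ⟨i, rfl⟩ := hmem x hx
      rw [ZeroAtInftyContinuousMap.sub_apply]
      have : (∑ j, smulC0 (χ j) (hχc j) (ContinuousMap.const X (φ (t j)))) (t i) =
          ∑ j, χ j (t i) • φ (t j) := by
        have := map_sum (ContinuousMap.coeFnAddMonoidHom.comp
          (⟨⟨fun f : C₀(X, V) => (f : C(X, V)), rfl⟩, fun _ _ => rfl⟩ : C₀(X, V) →+ C(X, V)))
          (fun j => smulC0 (χ j) (hχc j) (ContinuousMap.const X (φ (t j)))) Finset.univ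
        have := congrFun this (t i)
        rw [Finset.sum_apply] at this
        exact this
      rw [this, Finset.sum_eq_single i, hχ1, one_smul, sub_self]
      · intro j _ hj
        rw [hχ0 j i hj.symm, zero_smul]
      · simp
    rw [map_sub, map_sum, sub_eq_zero] at h0
    rw [h0]
    exact Finset.sum_congr rfl fun i _ => hcL i _
  have hnp : ∀ i, ‖p (t i)‖ = β := fun i => by
    have : t i ∈ {x | ‖p x‖ = β} := htp ▸ mem_range_self i
    exact this
  have hle : ∀ i, β * ‖c i‖ ≤ ⟪c i, p (t i)⟫ := by
    intro i
    rcases eq_or_ne (c i) 0 with h0 | h0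
    · simp [h0]
    have hcpos : 0 < ‖c i‖ := norm_pos_iff.2 h0
    -- The vector of length `β` that maximizes the pairing with `c i`. Bending `p` towards it near
    -- `t i` is a pointwise convex combination, so the bound `β` persists, and the values at the
    -- other `t j` do not change.
    set w : V := (β / ‖c i‖) • c i with hw
    have hwn : ‖w‖ = β := by
      rw [hw, norm_smul, Real.norm_of_nonneg (by positivity), div_mul_cancel₀ _ hcpos.ne']
    set φ := p + smulC0 (χ i) (hχc i) (ContinuousMap.const X w - (p : C(X, V))) with hφ
    have hφx : ∀ x, φ x = (1 - χ i x) • p x + χ i x • w := fun x => by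
      change p x + χ i x • (w - p x) = _
      rw [smul_sub, sub_smul, one_smul]; abel
    have hφn : ‖φ‖ ≤ β := zeroAtInfty_norm_le hβ.le fun x => by
      have := (convex_closedBall (0 : V) β) (x := p x) (by simpa using hp x) (y := w)
        (by simp [hwn]) (a := 1 - χ i x) (b := χ i x) (by linarith [(hχr i x).2])
        (hχr i x).1 (by ring)
      rw [hφx]
      simpa using this
    have h1 : q φ ≤ q p := by
      rw [hq, mul_comm]
      exact (le_abs_self _).trans ((q.le_opNorm _).trans
        (mul_le_mul_of_nonneg_left hφn (norm_nonneg _)))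
    rw [hrep, hrep, ← sub_nonpos, ← Finset.sum_sub_distrib, Finset.sum_eq_single i] at h1
    · rw [hφx, hχ1] at h1
      simp only [sub_self, zero_smul, one_smul, zero_add, hw, inner_smul_right,
        real_inner_self_eq_norm_sq] at h1
      have : β / ‖c i‖ * ‖c i‖ ^ 2 = β * ‖c i‖ := by field_simp
      linarith
    · intro j _ hj
      rw [hφx, hχ0 i j hj]
      simp
    · simp
  refine ⟨fun i => ‖c i‖, fun i => norm_nonneg _, fun φ => ?_⟩
  rw [hrep]
  refine Finset.sum_congr rfl fun i _ => ?_
  have hcs : ⟪c i, p (t i)⟫ = ‖c i‖ * ‖p (t i)‖ := by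
    refine le_antisymm (real_inner_le_norm _ _) ?_
    rw [hnp, mul_comm]
    exact hle i
  have h := (inner_eq_norm_mul_iff_real).1 hcs
  rw [hnp] at h
  have : c i = ‖c i‖ • β⁻¹ • p (t i) := by
    rw [smul_comm, ← h, smul_smul, inv_mul_cancel₀ hβ.ne', one_smul]
  conv_lhs => rw [this]
  rw [inner_smul_left, real_inner_comm]
  rfl

end Support

/-! ### Test functions, distributional derivatives and integration by parts -/

section TestFunctions

variable {T : ℝ} {d : ℕ}

/-- The derivative of a test function. -/
def Test.derivTest (φ : Test T d) : Test T d :=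
  ⟨_root_.deriv φ.1, (contDiff_infty_iff_deriv.1 φ.2.1).2, φ.2.2.1.deriv,
    (closure_minimal support_deriv_subset (isClosed_tsupport _)).trans φ.2.2.2⟩

theorem Test.derivTest_coe (φ : Test T d) : φ.derivTest.1 = _root_.deriv φ.1 := rfl

theorem Test.differentiable (φ : Test T d) : Differentiable ℝ φ.1 :=
  φ.2.1.differentiable (by simp)

theorem Test.eq_zero_of_notMem (φ : Test T d) {x : ℝ} (hx : x ∉ Ioo 0 T) : φ.1 x = 0 :=
  image_eq_zero_of_notMem_tsupport fun h => hx (φ.2.2.2 h)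

theorem Test.intervalIntegral_deriv (φ : Test T d) (a b : ℝ) :
    ∫ s in a..b, _root_.deriv φ.1 s = φ.1 b - φ.1 a :=
  intervalIntegral.integral_deriv_eq_sub (fun x _ => φ.differentiable x)
    (φ.derivTest.2.1.continuous.intervalIntegrable _ _)

theorem Test.memLp (φ : Test T d) : MemLp φ.1 2 (leb T) :=
  (φ.2.1.continuous.memLp_of_hasCompactSupport φ.2.2.1).restrict _

/-- Test functions as elements of `C₀(I; ℝ^d)`. -/
def toC0L (T : ℝ) (d : ℕ) : Test T d →ₗ[ℝ] C0 T d where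
  toFun := Test.toC0
  map_add' _ _ := rfl
  map_smul' _ _ := rfl

/-- The derivative of test functions, with values in `L²(I; ℝ^d)`. -/
def derivL2 (T : ℝ) (d : ℕ) : Test T d →ₗ[ℝ] Lp (Vec d) 2 (leb T) where
  toFun φ := φ.derivTest.memLp.toLp φ.derivTest.1
  map_add' φ ψ := by
    rw [← MemLp.toLp_add]
    congr 1
    funext x
    exact deriv_add (φ.differentiable x) (ψ.differentiable x)
  map_smul' c φ := by
    rw [RingHom.id_apply, ← MemLp.toLp_const_smul]
    congr 1
    funext x
    exact deriv_const_smul c (φ.differentiable x)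

theorem derivL2_coeFn (φ : Test T d) :
    (derivL2 T d φ : ℝ → Vec d) =ᵐ[leb T] _root_.deriv φ.1 :=
  φ.derivTest.memLp.coeFn_toLp

/-- The test functions are dense in `C₀(I; ℝ^d)`. -/
theorem exists_test_norm_sub_le (φ : C0 T d) {ε : ℝ} (hε : 0 < ε) :
    ∃ ψ : Test T d, ‖φ - ψ.toC0‖ ≤ ε := by
  have hδ : 0 < ε / 2 := by positivity
  -- Thresholding before extending by zero gives a continuous function supported in a compact subset
  -- of `I`; smoothing can then keep the support inside it.
  set f : ℝ → Vec d := fun x =>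
    if h : x ∈ Ioo 0 T then softThreshold (ε / 2) (φ ⟨x, h⟩) else 0 with hf
  set S : Set ℝ := (↑) '' {x : Ioo (0 : ℝ) T | ε / 2 ≤ ‖φ x‖} with hS
  have hSc : IsCompact S := (isCompact_setOf_le_norm φ hδ).image continuous_subtype_val
  have hSI : S ⊆ Ioo 0 T := by
    rintro _ ⟨x, -, rfl⟩
    exact x.2
  have hfS : ∀ x, x ∉ S → f x = 0 := by
    intro x hx
    by_cases h : x ∈ Ioo 0 T
    · simp only [hf, dif_pos h]
      refine softThreshold_of_norm_le hδ (le_of_not_ge fun h' => hx ⟨⟨x, h⟩, h', rfl⟩)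
    · simp only [hf, dif_neg h]
  have hfc : Continuous f := by
    rw [continuous_iff_continuousAt]
    intro x
    by_cases h : x ∈ Ioo 0 T
    · have hcomp : f ∘ ((↑) : Ioo (0 : ℝ) T → ℝ) = thresholdC0 hδ φ := by
        funext y
        simp only [Function.comp, hf, dif_pos y.2]
        rfl
      have := (isOpen_Ioo.isOpenEmbedding_subtypeVal.continuousAt_iff
        (f := ((↑) : Ioo (0 : ℝ) T → ℝ)) (g := f) (x := ⟨x, h⟩))
      refine this.1 ?_
      rw [hcomp]
      exact (map_continuous _).continuousAt
    · have hx : Sᶜ ∈ 𝓝 x := hSc.isClosed.isOpen_compl.mem_nhds fun h' => h (hSI h')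
      refine continuousAt_const.congr (f := fun _ => (0 : Vec d)) ?_
      filter_upwards [hx] with y hy
      exact (hfS y hy).symm
  obtain ⟨g, hg, hgf, hgs⟩ := hfc.exists_contDiff_approx ⊤ (ε := fun _ => ε / 2)
    continuous_const fun _ => hδ
  have hgS : tsupport g ⊆ S := closure_minimal
    (hgs.trans fun x hx => by by_contra h; exact hx (hfS x h)) hSc.isClosed
  refine ⟨⟨g, hg, hSc.of_isClosed_subset (isClosed_tsupport _) hgS, hgS.trans hSI⟩,
    zeroAtInfty_norm_le hε.le fun x => ?_⟩
  change ‖φ x - g x‖ ≤ ε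
  have h1 : ‖φ x - f x‖ ≤ ε / 2 := by
    simp only [hf, dif_pos x.2]
    rw [norm_sub_rev]
    exact norm_softThreshold_sub_le hδ (φ x)
  have h2 : ‖f x - g x‖ ≤ ε / 2 := by
    rw [← dist_eq_norm, dist_comm]
    exact (hgf x).le
  calc ‖φ x - g x‖ ≤ ‖φ x - f x‖ + ‖f x - g x‖ := norm_sub_le_norm_sub_add_norm_sub _ _ _
    _ ≤ ε := by linarith

/-- A real number whose absolute value is smaller than a multiple of every positive number
vanishes. -/
theorem eq_zero_of_abs_le_mul {a C : ℝ} (hC : 0 ≤ C) (h : ∀ ε > 0, |a| ≤ C * ε) : a = 0 := by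
  refine abs_eq_zero.1 (le_antisymm (le_of_forall_pos_le_add fun ε hε => ?_) (abs_nonneg a))
  have h1 := h (ε / (C + 1)) (by positivity)
  have h2 : C * (ε / (C + 1)) ≤ ε := by
    rw [mul_div_assoc', div_le_iff₀ (by positivity)]
    nlinarith
  linarith

namespace IsDistribDeriv

/-- Both functionals agree on the dense set of test functions. This allows the chosen `BV.deriv` to
be identified with explicit measures. -/
theorem unique {u : ℝ → Vec d} {q r : Meas T d} (hq : IsDistribDeriv u q)
    (hr : IsDistribDeriv u r) : q = r := by
  ext φ
  rw [← sub_eq_zero]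
  refine eq_zero_of_abs_le_mul (norm_nonneg (q - r)) fun ε hε => ?_
  obtain ⟨ψ, hψ⟩ := exists_test_norm_sub_le φ hε
  have h : q ψ.toC0 = r ψ.toC0 := by
    have := (hq ψ).symm.trans (hr ψ)
    linarith
  have h2 : q φ - r φ = (q - r) (φ - ψ.toC0) := by
    simp only [map_sub, _root_.sub_apply, h]
    ring
  rw [h2]
  exact ((q - r).le_opNorm _).trans (mul_le_mul_of_nonneg_left hψ (norm_nonneg _))

theorem congr_ae {u v : ℝ → Vec d} {q : Meas T d} (hq : IsDistribDeriv u q)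
    (h : u =ᵐ[leb T] v) : IsDistribDeriv v q := fun φ => by
  rw [← hq φ]
  refine integral_congr_ae ?_
  filter_upwards [h] with s hs
  rw [hs]

theorem add {u v : ℝ → Vec d} (hu : Integrable u (leb T)) (hv : Integrable v (leb T))
    {q r : Meas T d} (hq : IsDistribDeriv u q) (hr : IsDistribDeriv v r) :
    IsDistribDeriv (u + v) (q + r) := fun φ => by
  have h := integral_add (φ.derivTest.integrable_inner hu) (φ.derivTest.integrable_inner hv)
  rw [Test.derivTest_coe, hq φ, hr φ] at h
  rw [_root_.add_apply, neg_add, ← h]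
  exact integral_congr_ae (ae_of_all _ fun s => inner_add_left _ _ _)

theorem const_smul {u : ℝ → Vec d} {q : Meas T d} (hq : IsDistribDeriv u q) (c : ℝ) :
    IsDistribDeriv (c • u) (c • q) := fun φ => by
  have h := integral_const_mul (μ := leb T) c fun s => ⟪u s, _root_.deriv φ.1 s⟫
  rw [hq φ] at h
  rw [_root_.smul_apply, smul_eq_mul, ← mul_neg, ← h]
  exact integral_congr_ae (ae_of_all _ fun s => real_inner_smul_left _ _ _)

/-- The derivative of a jump is a Dirac measure. -/
theorem step (t : Ioo (0 : ℝ) T) (c : Vec d) :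
    IsDistribDeriv ((Ioo (t : ℝ) T).indicator fun _ => c) (dirac t c) := fun φ => by
  have h1 : ∀ s, ⟪(Ioo (t : ℝ) T).indicator (fun _ => c) s, _root_.deriv φ.1 s⟫ =
      (Ioo (t : ℝ) T).indicator (fun s => ⟪c, _root_.deriv φ.1 s⟫) s := fun s => by
    by_cases h : s ∈ Ioo (t : ℝ) T <;> simp [h]
  simp_rw [h1]
  rw [setIntegral_indicator measurableSet_Ioo,
    inter_eq_self_of_subset_right (Ioo_subset_Ioo_left t.2.1.le), integral_inner,
    ← integral_Ioc_eq_integral_Ioo, ← intervalIntegral.integral_of_le t.2.2.le,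
    φ.intervalIntegral_deriv, φ.eq_zero_of_notMem (by simp), zero_sub, inner_neg_right, dirac_apply,
    Test.toC0_apply, real_inner_comm]
  exact φ.derivTest.integrable.integrableOn

theorem const (hT : 0 < T) (c : Vec d) :
    IsDistribDeriv (fun _ => c) (0 : Meas T d) := fun φ => by
  have h := integral_inner (𝕜 := ℝ) (φ.derivTest.integrable.integrableOn (s := Ioo 0 T)) c
  rw [Test.derivTest_coe] at h
  rw [h, ← integral_Ioc_eq_integral_Ioo, ← intervalIntegral.integral_of_le hT.le,
    φ.intervalIntegral_deriv, φ.eq_zero_of_notMem (by simp), φ.eq_zero_of_notMem (by simp)]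
  simp

end IsDistribDeriv

/-- The lemma of du Bois-Reymond. -/
theorem exists_ae_eq_const (hT : 0 < T) {w : ℝ → Vec d} (hw : Integrable w (leb T))
    (h : IsDistribDeriv w (0 : Meas T d)) : ∃ c, ∀ᵐ s ∂(leb T), w s = c := by
  obtain ⟨η, hη, hηc, hηs, hη1⟩ := exists_bump hT
  have hbdd : ∀ γ : ℝ → ℝ, ContDiff ℝ ∞ γ → HasCompactSupport γ →
      ∀ v : ℝ → Vec d, Integrable v (leb T) → Integrable (fun s => γ s • v s) (leb T) := by
    intro γ hγ hγc v hv
    obtain ⟨M, hM⟩ := hγc.exists_bound_of_continuous hγ.continuous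
    exact hv.bdd_smul M hγ.continuous.aestronglyMeasurable (ae_of_all _ hM)
  -- The constant must be the mean of `w` weighted by `η`, since `η` has integral one.
  set c := ∫ s in Ioo 0 T, η s • w s with hc
  refine ⟨c, ?_⟩
  have hwc : Integrable (fun s => w s - c) (leb T) := hw.sub (integrable_const c)
  have hae : ∀ᵐ s ∂(volume : Measure ℝ), s ∈ Ioo 0 T → w s - c = 0 := by
    refine isOpen_Ioo.ae_eq_zero_of_integral_contDiff_smul_eq_zero
      (IntegrableOn.locallyIntegrableOn hwc) fun γ hγ hγc hγs => ?_
    have hres : ∀ {V : Type} [NormedAddCommGroup V] [NormedSpace ℝ V] (f : ℝ → V),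
        ∫ s, γ s • f s = ∫ s in Ioo 0 T, γ s • f s := fun f =>
      (setIntegral_eq_integral_of_forall_compl_eq_zero fun s hs => by
        rw [image_eq_zero_of_notMem_tsupport fun h => hs (hγs h), zero_smul]).symm
    rw [hres]
    refine ext_inner_left ℝ fun e => ?_
    rw [inner_zero_right]
    set m := ∫ s, γ s with hm
    have hm' : ∫ s in Ioo 0 T, γ s = m := by
      have := hres fun _ => (1 : ℝ)
      simpa using this.symm
    let ψ : Test T d := ⟨fun s => γ s • e, hγ.smul contDiff_const, hγc.smul_right,
      (tsupport_smul_subset_left γ _).trans hγs⟩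
    -- Subtracting this multiple of the bump makes the integral of `ψ` vanish, so that `ψ - E` is a
    -- derivative of a test function.
    let E : Test T d := ⟨fun s => η s • m • e, hη.smul contDiff_const, hηc.smul_right,
      (tsupport_smul_subset_left η _).trans hηs⟩
    have hz : ∫ s, (ψ - E).1 s = 0 := by
      change ∫ s, (ψ.1 s - E.1 s) = 0
      rw [integral_sub ψ.integrable E.integrable]
      change (∫ s, γ s • e) - ∫ s, η s • m • e = 0
      rw [integral_smul_const, integral_smul_const, hη1, one_smul, sub_self]
    obtain ⟨Φ, hΦ, -⟩ := (ψ - E).exists_primitive hT hz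
    have h0 := h Φ
    rw [hΦ, _root_.zero_apply, neg_zero] at h0
    have hsplit : ∫ s in Ioo 0 T, ⟪w s, (ψ - E).1 s⟫ =
        ⟪e, ∫ s in Ioo 0 T, γ s • w s⟫ - m * ⟪e, c⟫ := by
      rw [hc, ← integral_inner (hbdd γ hγ hγc w hw), ← integral_inner (hbdd η hη hηc w hw),
        ← integral_const_mul, ← integral_sub ((hbdd γ hγ hγc w hw).const_inner e)
          (((hbdd η hη hηc w hw).const_inner e).const_mul m)]
      refine integral_congr_ae (ae_of_all _ fun s => ?_)
      change ⟪w s, γ s • e - η s • m • e⟫ = ⟪e, γ s • w s⟫ - m * ⟪e, η s • w s⟫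
      simp only [inner_sub_right, inner_smul_right, real_inner_comm e (w s)]
      ring
    have hsub : ∫ s in Ioo 0 T, γ s • (w s - c) = (∫ s in Ioo 0 T, γ s • w s) - m • c := by
      rw [← hm', ← integral_smul_const, ← integral_sub (hbdd γ hγ hγc w hw)
        (hbdd γ hγ hγc _ (integrable_const c))]
      exact integral_congr_ae (ae_of_all _ fun s => smul_sub _ _ _)
    rw [hsub, inner_sub_right, inner_smul_right, ← hsplit, h0]
  filter_upwards [(ae_restrict_iff' measurableSet_Ioo).2 hae] with s hs
  exact sub_eq_zero.1 hs

theorem Lp2_integrable (v : Lp (Vec d) 2 (leb T)) : Integrable v (leb T) :=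
  (Lp.memLp v).integrable (by norm_num)

/-- The functions of vanishing mean are limits of derivatives of test functions. -/
theorem exists_test_derivL2_close (hT : 0 < T) (g : Lp (Vec d) 2 (leb T))
    (hg : ∫ s in Ioo 0 T, g s = 0) {ε : ℝ} (hε : 0 < ε) :
    ∃ φ : Test T d, ‖g - derivL2 T d φ‖ ≤ ε := by
  -- The closure is the double orthogonal complement. A function orthogonal to all derivatives of
  -- test functions is constant by du Bois-Reymond, hence orthogonal to `g`.
  have hmem : g ∈ (LinearMap.range (derivL2 T d)).topologicalClosure := by
    rw [← Submodule.orthogonal_orthogonal_eq_closure, Submodule.mem_orthogonal]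
    intro w hw
    have hw0 : IsDistribDeriv w (0 : Meas T d) := fun φ => by
      have h := (Submodule.mem_orthogonal' _ _).1 hw _ ⟨φ, rfl⟩
      rw [L2.inner_def] at h
      rw [_root_.zero_apply, neg_zero]
      refine Eq.trans (integral_congr_ae ?_) h
      filter_upwards [derivL2_coeFn φ] with s hs
      rw [hs]
    obtain ⟨c, hc⟩ := exists_ae_eq_const hT (Lp2_integrable w) hw0
    rw [L2.inner_def]
    calc ∫ s, ⟪w s, g s⟫ ∂(leb T) = ∫ s in Ioo 0 T, ⟪c, g s⟫ := by
          refine integral_congr_ae ?_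
          filter_upwards [hc] with s hs
          rw [hs]
      _ = 0 := by rw [integral_inner (Lp2_integrable g), hg, inner_zero_right]
  obtain ⟨_, ⟨φ, rfl⟩, hφ⟩ := Metric.mem_closure_iff.1 hmem ε hε
  exact ⟨φ, by rw [← dist_eq_norm]; exact hφ.le⟩

/-- Hölder's inequality on a set of finite measure. It turns `L²` bounds into uniform bounds for
primitives. -/
theorem exists_integral_norm_le (T : ℝ) (d : ℕ) : ∃ C : ℝ, 0 ≤ C ∧
    ∀ h : Lp (Vec d) 2 (leb T), ∫ s in Ioo 0 T, ‖h s‖ ≤ C * ‖h‖ := by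
  refine ⟨((leb T univ) ^ (1 / (1 : ENNReal).toReal - 1 / (2 : ENNReal).toReal)).toReal,
    ENNReal.toReal_nonneg, fun h => ?_⟩
  have h1 := eLpNorm_le_eLpNorm_mul_rpow_measure_univ (μ := leb T) (p := 1) (q := 2)
    (by norm_num) (Lp.memLp h).1
  have h2 : ∫ s in Ioo 0 T, ‖h s‖ = (eLpNorm h 1 (leb T)).toReal := by
    rw [eLpNorm_one_eq_lintegral_enorm, ← integral_norm_eq_lintegral_enorm (Lp.memLp h).1]
  rw [h2, Lp.norm_def, mul_comm, ← ENNReal.toReal_mul]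
  refine ENNReal.toReal_mono (ENNReal.mul_ne_top (Lp.memLp h).2.ne ?_) h1
  exact (ENNReal.rpow_lt_top_of_nonneg (by norm_num) (measure_ne_top _ _)).ne

/-- A continuous function that vanishes at the end points defines an element of `C₀`. -/
theorem exists_C0_of_continuousOn {f : ℝ → Vec d} (hf : ContinuousOn f (Icc 0 T))
    (h0 : f 0 = 0) (hT : f T = 0) : ∃ p : C0 T d, ∀ s : Ioo (0 : ℝ) T, p s = f s := by
  refine ⟨⟨⟨fun s => f s, (hf.mono Ioo_subset_Icc_self).domRestrict⟩, ?_⟩, fun _ => rfl⟩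
  rw [Metric.tendsto_nhds]
  intro ε hε
  have hS : IsCompact (Icc 0 T ∩ {x | ε ≤ ‖f x‖}) :=
    isCompact_Icc.of_isClosed_subset
      (hf.norm.preimage_isClosed_of_isClosed isClosed_Icc isClosed_Ici) inter_subset_left
  have hK : IsCompact (((↑) : Ioo (0 : ℝ) T → ℝ) ⁻¹' (Icc 0 T ∩ {x | ε ≤ ‖f x‖})) := by
    refine Topology.IsInducing.subtypeVal.isCompact_preimage' hS ?_
    rw [Subtype.range_coe]
    rintro x ⟨hx, hxε⟩
    have hx0 : f x ≠ 0 := fun h => by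
      have : ε ≤ ‖f x‖ := hxε
      rw [h, norm_zero] at this
      linarith
    exact ⟨lt_of_le_of_ne hx.1 fun h => hx0 (h ▸ h0), lt_of_le_of_ne hx.2 fun h => hx0 (h ▸ hT)⟩
  filter_upwards [hK.compl_mem_cocompact] with s hs
  rw [dist_zero_right]
  by_contra h
  exact hs ⟨Ioo_subset_Icc_self s.2, not_lt.1 h⟩

theorem exists_primitiveC0 (hT : 0 < T) (g : Lp (Vec d) 2 (leb T))
    (hg : ∫ s in Ioo 0 T, g s = 0) :
    ∃ p : C0 T d, ∀ s : Ioo (0 : ℝ) T, p s = ∫ x in (0 : ℝ)..s, g x := by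
  refine exists_C0_of_continuousOn (f := fun s => ∫ x in (0 : ℝ)..s, g x) ?_ (by simp) ?_
  · rw [← uIcc_of_le hT.le]
    refine intervalIntegral.continuousOn_primitive_interval ?_
    rw [uIcc_of_le hT.le]
    exact (integrableOn_Icc_iff_integrableOn_Ioo).2 (Lp2_integrable g)
  · rw [intervalIntegral.integral_of_le hT.le, integral_Ioc_eq_integral_Ioo, hg]

/-- Integration by parts against a primitive of a square integrable function. -/
theorem IsDistribDeriv.inner_eq (hT : 0 < T) {v : Lp (Vec d) 2 (leb T)} {q : Meas T d}
    (hq : IsDistribDeriv v q) {g : Lp (Vec d) 2 (leb T)} (hg : ∫ s in Ioo 0 T, g s = 0)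
    {p : C0 T d} (hp : ∀ s : Ioo (0 : ℝ) T, p s = ∫ x in (0 : ℝ)..s, g x) :
    ⟪v, g⟫ = -q p := by
  obtain ⟨C, hC0, hC⟩ := exists_integral_norm_le T d
  rw [← sub_eq_zero]
  -- The identity holds for derivatives of test functions. If `φ'` is `ε`-close to `g` in `L²`, then
  -- `φ` is uniformly `C * ε`-close to `p`; the two errors add up to this constant times `ε`.
  refine eq_zero_of_abs_le_mul (C := ‖v‖ + ‖q‖ * C) (by positivity) fun ε hε => ?_
  obtain ⟨φ, hφ⟩ := exists_test_derivL2_close hT g hg hε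
  have h1 : ⟪v, derivL2 T d φ⟫ = -q φ.toC0 := by
    rw [L2.inner_def, ← hq φ]
    refine integral_congr_ae ?_
    filter_upwards [derivL2_coeFn φ] with s hs
    rw [hs]
  have h2 : ‖p - φ.toC0‖ ≤ C * ε := by
    refine zeroAtInfty_norm_le (by positivity) fun s => ?_
    have hae : ∀ᵐ x ∂(leb T), (g - derivL2 T d φ : Lp (Vec d) 2 (leb T)) x =
        g x - _root_.deriv φ.1 x := by
      filter_upwards [derivL2_coeFn φ, Lp.coeFn_sub g (derivL2 T d φ)] with x hx hx'
      rw [hx', Pi.sub_apply, hx]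
    have hint : Integrable (fun x => g x - _root_.deriv φ.1 x) (leb T) :=
      (Lp2_integrable _).congr hae
    have hsub : p s - φ.toC0 s = ∫ x in (0 : ℝ)..s, (g x - _root_.deriv φ.1 x) := by
      rw [intervalIntegral.integral_sub, φ.intervalIntegral_deriv,
        φ.eq_zero_of_notMem (x := 0) (by simp), sub_zero, hp, Test.toC0_apply]
      · refine (intervalIntegrable_iff_integrableOn_Ioo_of_le s.2.1.le).2 ?_
        exact (Lp2_integrable g).mono_measure
          (Measure.restrict_mono (Ioo_subset_Ioo_right s.2.2.le) le_rfl)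
      · exact φ.derivTest.2.1.continuous.intervalIntegrable _ _
    rw [ZeroAtInftyContinuousMap.sub_apply, hsub]
    refine intervalIntegral.norm_integral_le_integral_norm_uIoc.trans ?_
    rw [uIoc_of_le s.2.1.le]
    calc ∫ x in Ioc 0 (s : ℝ), ‖g x - _root_.deriv φ.1 x‖
        ≤ ∫ x in Ioo 0 T, ‖g x - _root_.deriv φ.1 x‖ :=
          setIntegral_mono_set hint.norm (ae_of_all _ fun _ => norm_nonneg _)
            (Eventually.of_forall fun x hx => ⟨hx.1, hx.2.trans_lt s.2.2⟩)
      _ = ∫ x in Ioo 0 T, ‖(g - derivL2 T d φ : Lp (Vec d) 2 (leb T)) x‖ := by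
          refine integral_congr_ae ?_
          filter_upwards [hae] with x hx
          rw [hx]
      _ ≤ C * ε := (hC _).trans (mul_le_mul_of_nonneg_left hφ hC0)
  have h3 : ⟪v, g⟫ - -q p = ⟪v, g - derivL2 T d φ⟫ + q (p - φ.toC0) := by
    rw [inner_sub_right, h1, map_sub]; ring
  rw [h3]
  calc |⟪v, g - derivL2 T d φ⟫ + q (p - φ.toC0)|
      ≤ |⟪v, g - derivL2 T d φ⟫| + |q (p - φ.toC0)| := abs_add_le _ _
    _ ≤ ‖v‖ * ε + ‖q‖ * (C * ε) := add_le_add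
        ((abs_real_inner_le_norm _ _).trans (mul_le_mul_of_nonneg_left hφ (norm_nonneg _)))
        ((q.le_opNorm _).trans (mul_le_mul_of_nonneg_left h2 (norm_nonneg _)))
    _ = (‖v‖ + ‖q‖ * C) * ε := by ring

end TestFunctions

/-! ### Semicontinuity of total variation and the embedding into `L²` -/

section Embedding

variable {T : ℝ} {d : ℕ}

/-- The bound makes `ℓ` factor through the range of `J`, and Hahn-Banach extends it from there with
the same norm. With test functions mapped into `C₀` this produces measures. -/
theorem exists_dual_of_abs_le {V E : Type*} [AddCommGroup V] [Module ℝ V] [NormedAddCommGroup E]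
    [NormedSpace ℝ E] (J : V →ₗ[ℝ] E) (ℓ : V →ₗ[ℝ] ℝ) {M : ℝ} (hM : 0 ≤ M)
    (h : ∀ v, |ℓ v| ≤ M * ‖J v‖) : ∃ q : StrongDual ℝ E, ‖q‖ ≤ M ∧ ∀ v, q (J v) = ℓ v := by
  have hker : LinearMap.ker J ≤ LinearMap.ker ℓ := fun v hv => by
    have h := h v
    rw [LinearMap.mem_ker.1 hv, norm_zero, mul_zero] at h
    exact LinearMap.mem_ker.2 (abs_eq_zero.1 (le_antisymm h (abs_nonneg _)))
  let g : LinearMap.range J →ₗ[ℝ] ℝ :=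
    ((LinearMap.ker J).liftQ ℓ hker).comp J.quotKerEquivRange.symm.toLinearMap
  have hg : ∀ v : V, g ⟨J v, v, rfl⟩ = ℓ v := fun v => by
    have : J.quotKerEquivRange.symm ⟨J v, v, rfl⟩ = (LinearMap.ker J).mkQ v := by
      rw [LinearEquiv.symm_apply_eq]
      rfl
    change (LinearMap.ker J).liftQ ℓ hker (J.quotKerEquivRange.symm ⟨J v, v, rfl⟩) = ℓ v
    rw [this]
    rfl
  have hgb : ∀ x, ‖g x‖ ≤ M * ‖x‖ := by
    rintro ⟨_, v, rfl⟩
    rw [hg]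
    exact h v
  obtain ⟨H, hH, hn⟩ := exists_extension_norm_eq (LinearMap.range J) (g.mkContinuous M hgb)
  exact ⟨H, hn ▸ LinearMap.mkContinuous_norm_le _ hM _,
    fun v => (hH ⟨J v, v, rfl⟩).trans (hg v)⟩

theorem IsDistribDeriv.inner_derivL2 {v : Lp (Vec d) 2 (leb T)} {q : Meas T d}
    (hq : IsDistribDeriv v q) (φ : Test T d) : ⟪v, derivL2 T d φ⟫ = -q φ.toC0 := by
  rw [L2.inner_def, ← hq φ]
  refine integral_congr_ae ?_
  filter_upwards [derivL2_coeFn φ] with s hs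
  rw [hs]

/-- Lower semicontinuity of the total variation. -/
theorem exists_isDistribDeriv_of_tendsto {v : ℕ → Lp (Vec d) 2 (leb T)} {q : ℕ → Meas T d}
    {v₀ : Lp (Vec d) 2 (leb T)} {M : ℕ → ℝ} {M₀ : ℝ} (hv : Tendsto v atTop (𝓝 v₀))
    (hq : ∀ k, IsDistribDeriv (v k) (q k)) (hqM : ∀ k, ‖q k‖ ≤ M k)
    (hM : Tendsto M atTop (𝓝 M₀)) :
    ∃ q₀ : Meas T d, IsDistribDeriv v₀ q₀ ∧ ‖q₀‖ ≤ M₀ := by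
  have hM0 : 0 ≤ M₀ := ge_of_tendsto' hM fun k => (norm_nonneg (q k)).trans (hqM k)
  -- The functional that the derivative of `v₀` has to extend; its bound by `M₀` is the limit of the
  -- bounds for `v k`.
  let ℓ : Test T d →ₗ[ℝ] ℝ := -((innerSL ℝ v₀).toLinearMap.comp (derivL2 T d))
  have hℓ : ∀ φ, ℓ φ = -⟪v₀, derivL2 T d φ⟫ := fun φ => rfl
  obtain ⟨q₀, hq₀, h⟩ := exists_dual_of_abs_le (toC0L T d) ℓ hM0 fun φ => by
    rw [hℓ, abs_neg]
    refine le_of_tendsto_of_tendsto' (hv.inner tendsto_const_nhds).abs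
      (hM.mul_const ‖toC0L T d φ‖) fun k => ?_
    rw [(hq k).inner_derivL2, abs_neg]
    exact ((q k).le_opNorm _).trans (mul_le_mul_of_nonneg_right (hqM k) (norm_nonneg _))
  refine ⟨q₀, fun φ => ?_, hq₀⟩
  have h1 : q₀ φ.toC0 = -⟪v₀, derivL2 T d φ⟫ := h φ
  rw [h1, neg_neg, L2.inner_def]
  refine integral_congr_ae ?_
  filter_upwards [derivL2_coeFn φ] with s hs
  rw [hs]

namespace BV

theorem toL2_coeFn (u : BV T d) : (u.toL2 : ℝ → Vec d) =ᵐ[leb T] u.1 := MemLp.coeFn_toLp _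

theorem isDistribDeriv_toL2 (u : BV T d) : IsDistribDeriv u.toL2 u.deriv :=
  u.isDistribDeriv.congr_ae u.toL2_coeFn.symm

theorem memLp_one (v : Lp (Vec d) 2 (leb T)) : MemLp v 1 (leb T) :=
  (Lp.memLp v).mono_exponent (by norm_num)

/-- The function of bounded variation given by a square integrable function. -/
def ofL2 (v : Lp (Vec d) 2 (leb T)) (q : Meas T d) (h : IsDistribDeriv v q) : BV T d :=
  ⟨(memLp_one v).toLp v, q, h.congr_ae (memLp_one v).coeFn_toLp.symm⟩

variable {v : Lp (Vec d) 2 (leb T)} {q : Meas T d} (h : IsDistribDeriv v q)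

theorem toL2_ofL2 : (ofL2 v q h).toL2 = v :=
  Lp.ext ((ofL2 v q h).toL2_coeFn.trans (memLp_one v).coeFn_toLp)

theorem deriv_ofL2 : (ofL2 v q h).deriv = q := by
  have := (ofL2 v q h).isDistribDeriv_toL2
  rw [toL2_ofL2] at this
  exact this.unique h

theorem ext_toL2 {u w : BV T d} (h : u.toL2 = w.toL2) : u = w := by
  refine Subtype.ext (Lp.ext ?_)
  refine u.toL2_coeFn.symm.trans ?_
  rw [h]
  exact w.toL2_coeFn

end BV

theorem stepL2_coeFn (t : ℝ) (c : Vec d) :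
    (stepL2 T t c : ℝ → Vec d) =ᵐ[leb T] (Ioo t T).indicator fun _ => c :=
  indicatorConstLp_coeFn

theorem stepL2_zero_coeFn (c : Vec d) : ∀ᵐ s ∂(leb T), stepL2 T 0 c s = c := by
  filter_upwards [stepL2_coeFn (T := T) 0 c, ae_restrict_mem measurableSet_Ioo] with s hs hsI
  rw [hs, indicator_of_mem hsI]

theorem inner_stepL2_zero (a : Vec d) (g : Lp (Vec d) 2 (leb T)) :
    ⟪stepL2 T 0 a, g⟫ = ⟪a, ∫ s in Ioo 0 T, g s⟫ := by
  rw [L2.inner_def, ← integral_inner (Lp2_integrable g)]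
  refine integral_congr_ae ?_
  filter_upwards [stepL2_zero_coeFn (T := T) a] with s hs
  rw [hs]

theorem leb_real_univ (hT : 0 < T) : (leb T).real univ = T := by
  simp [measureReal_def, hT.le]

theorem integral_norm_coeFn_eq (u : Lp (Vec d) 1 (leb T)) : ∫ s in Ioo 0 T, ‖u s‖ = ‖u‖ :=
  (L1.norm_eq_integral_norm u).symm

/-- The embedding of `BV` into `L²` is bounded. -/
theorem BV.exists_norm_toL2_le (hT : 0 < T) (d : ℕ) :
    ∃ C : ℝ, ∀ u : BV T d, ‖u.toL2‖ ≤ C * u.norm := by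
  obtain ⟨C, hC0, hC⟩ := exists_integral_norm_le T d
  -- The `L²` norm of the constant function one.
  set D : ℝ := T ^ (1 / (2 : ENNReal).toReal) with hD
  have hD0 : 0 ≤ D := Real.rpow_nonneg hT.le _
  refine ⟨C + D * T⁻¹, fun u => ?_⟩
  set v := u.toL2 with hv
  set a : Vec d := T⁻¹ • ∫ s in Ioo 0 T, v s with ha
  -- The part of vanishing mean. Testing `v` with it gives `‖g‖² = -u'(p)` for its primitive `p`,
  -- and `‖p‖ ≤ C * ‖g‖` then yields `‖g‖ ≤ C * ‖u'‖`.
  set g : Lp (Vec d) 2 (leb T) := v - stepL2 T 0 a with hg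
  have hgae : ∀ᵐ s ∂(leb T), g s = v s - a := by
    filter_upwards [stepL2_zero_coeFn (T := T) a, Lp.coeFn_sub v (stepL2 T 0 a)] with s hs hs'
    rw [hs', Pi.sub_apply, hs]
  have hg0 : ∫ s in Ioo 0 T, g s = 0 := by
    rw [integral_congr_ae hgae, integral_sub (Lp2_integrable v) (integrable_const _),
      integral_const, leb_real_univ hT, ha, smul_inv_smul₀ hT.ne', sub_self]
  obtain ⟨p, hp⟩ := exists_primitiveC0 hT g hg0
  have h1 : ⟪v, g⟫ = -u.deriv p := u.isDistribDeriv_toL2.inner_eq hT hg0 hp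
  have h2 : ‖p‖ ≤ C * ‖g‖ := by
    refine zeroAtInfty_norm_le (by positivity) fun s => ?_
    rw [hp]
    refine intervalIntegral.norm_integral_le_integral_norm_uIoc.trans (le_trans ?_ (hC g))
    rw [uIoc_of_le s.2.1.le]
    exact setIntegral_mono_set (Lp2_integrable g).norm (ae_of_all _ fun _ => norm_nonneg _)
      (Eventually.of_forall fun x hx => ⟨hx.1, hx.2.trans_lt s.2.2⟩)
  have h3 : ⟪stepL2 T 0 a, g⟫ = 0 := by
    rw [inner_stepL2_zero, hg0, inner_zero_right]
  have h4 : ‖g‖ ^ 2 = -u.deriv p := by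
    rw [← h1, ← real_inner_self_eq_norm_sq, ← sub_zero ⟪v, g⟫, ← h3, ← inner_sub_left]
  have h5 : ‖g‖ ≤ C * ‖u.deriv‖ := by
    have h6 : -u.deriv p ≤ ‖u.deriv‖ * (C * ‖g‖) := (neg_le_abs _).trans
      ((u.deriv.le_opNorm _).trans (mul_le_mul_of_nonneg_left h2 (norm_nonneg _)))
    rcases (norm_nonneg g).eq_or_lt with h0 | h0
    · rw [← h0]; positivity
    · nlinarith
  have h7 : ‖a‖ ≤ T⁻¹ * ‖u.1‖ := by
    rw [ha, norm_smul, Real.norm_of_nonneg (inv_nonneg.2 hT.le), integral_congr_ae u.toL2_coeFn,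
      ← integral_norm_coeFn_eq]
    exact mul_le_mul_of_nonneg_left (norm_integral_le_integral_norm _) (inv_nonneg.2 hT.le)
  have h8 : ‖stepL2 T 0 a‖ = ‖a‖ * D := by
    rw [stepL2, norm_indicatorConstLp (by norm_num) (by norm_num), hD]
    simp [measureReal_def, hT.le]
  have h9 : v = g + stepL2 T 0 a := by rw [hg, sub_add_cancel]
  calc ‖v‖ ≤ ‖g‖ + ‖stepL2 T 0 a‖ := by rw [h9]; exact norm_add_le _ _
    _ ≤ C * ‖u.deriv‖ + T⁻¹ * ‖u.1‖ * D := by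
        rw [h8]; exact add_le_add h5 (mul_le_mul_of_nonneg_right h7 hD0)
    _ ≤ (C + D * T⁻¹) * u.norm := by
        have : 0 ≤ D * T⁻¹ * ‖u.deriv‖ := by positivity
        have : 0 ≤ C * ‖u.1‖ := by positivity
        rw [BV.norm]
        nlinarith

end Embedding

/-! ### Existence of a minimizer -/

section Existence

/-- Nested nonempty bounded closed convex subsets of a Hilbert space have a common point. -/
theorem nonempty_iInter_of_convex {E : Type*} [NormedAddCommGroup E] [InnerProductSpace ℝ E]
    [CompleteSpace E] {C : ℕ → Set E} (hC : Antitone C) (hne : ∀ n, (C n).Nonempty)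
    (hcl : ∀ n, IsClosed (C n)) (hconv : ∀ n, Convex ℝ (C n)) {R : ℝ}
    (hR : ∀ x ∈ C 0, ‖x‖ ≤ R) : (⋂ n, C n).Nonempty := by
  -- The elements of minimal norm will converge: their norms increase and stay bounded.
  have hmin : ∀ n, ∃ x ∈ C n, ∀ y ∈ C n, ‖x‖ ≤ ‖y‖ := fun n => by
    obtain ⟨x, hx, h⟩ := exists_norm_eq_iInf_of_complete_convex (hne n) (hcl n).isComplete
      (hconv n) 0
    refine ⟨x, hx, fun y hy => ?_⟩
    rw [zero_sub, norm_neg] at h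
    rw [h]
    refine (ciInf_le ⟨0, ?_⟩ (⟨y, hy⟩ : C n)).trans (by simp)
    rintro _ ⟨z, rfl⟩
    exact norm_nonneg _
  choose x hxC hx using hmin
  have hmono : Monotone fun n => ‖x n‖ := fun n m h => hx n _ (hC h (hxC m))
  have hmono2 : Monotone fun n => ‖x n‖ ^ 2 := fun n m h =>
    pow_le_pow_left₀ (norm_nonneg _) (hmono h) 2
  have hbdd : BddAbove (range fun n => ‖x n‖ ^ 2) := by
    refine ⟨R ^ 2, ?_⟩
    rintro _ ⟨n, rfl⟩
    exact pow_le_pow_left₀ (norm_nonneg _) (hR _ (hC (Nat.zero_le n) (hxC n))) 2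
  -- The midpoint of `x n` and `x m` lies in `C n`, so its norm is at least `‖x n‖`; the
  -- parallelogram law does the rest.
  have hdist : ∀ n m, n ≤ m → ‖x m - x n‖ ^ 2 ≤ 2 * (‖x m‖ ^ 2 - ‖x n‖ ^ 2) := fun n m h => by
    have hmid := hx n _ ((hconv n) (hxC n) (hC h (hxC m)) (a := 1 / 2) (b := 1 / 2)
      (by norm_num) (by norm_num) (by norm_num))
    rw [← smul_add, norm_smul, Real.norm_of_nonneg (by norm_num), add_comm] at hmid
    have hp := parallelogram_law_with_norm ℝ (x m) (x n)
    nlinarith [norm_nonneg (x n)]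
  have hcauchy : CauchySeq x := by
    have hc := (tendsto_atTop_ciSup hmono2 hbdd).cauchySeq
    rw [Metric.cauchySeq_iff'] at hc ⊢
    intro ε hε
    obtain ⟨N, hN⟩ := hc (ε ^ 2 / 2) (by positivity)
    refine ⟨N, fun n hn => ?_⟩
    have h1 := (le_abs_self _).trans_lt (hN n hn)
    have h2 := hdist N n hn
    rw [dist_eq_norm]
    exact lt_of_pow_lt_pow_left₀ 2 hε.le (by linarith)
  obtain ⟨z, hz⟩ := cauchySeq_tendsto_of_complete hcauchy
  refine ⟨z, mem_iInter.2 fun n => (hcl n).mem_of_tendsto hz ?_⟩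
  filter_upwards [eventually_ge_atTop n] with m hm
  exact hC hm (hxC m)

variable {T : ℝ} {d : ℕ} {Y : Type*} [NormedAddCommGroup Y] [InnerProductSpace ℝ Y]
  {K : Lp (Vec d) 2 (leb T) →L[ℝ] Y} {F : Y → ℝ} {β : ℝ}

theorem objective_ofL2 {v : Lp (Vec d) 2 (leb T)} {q : Meas T d} (h : IsDistribDeriv v q) :
    objective K F β (BV.ofL2 v q h) = F (K v) + β * ‖q‖ := by
  rw [objective, BV.toL2_ofL2, BV.deriv_ofL2]

theorem IsDistribDeriv.combo {v w : Lp (Vec d) 2 (leb T)} {q r : Meas T d}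
    (hq : IsDistribDeriv v q) (hr : IsDistribDeriv w r) (a b : ℝ) :
    IsDistribDeriv (a • v + b • w : Lp (Vec d) 2 (leb T)) (a • q + b • r) := by
  refine ((hq.const_smul a).add ((Lp2_integrable v).smul a) ((Lp2_integrable w).smul b)
    (hr.const_smul b)).congr_ae ?_
  filter_upwards [Lp.coeFn_add (a • v) (b • w), Lp.coeFn_smul a v, Lp.coeFn_smul b w]
    with s h1 h2 h3
  rw [h1, Pi.add_apply, Pi.add_apply, h2, h3]

theorem RadiallyUnbounded.exists_bound (hrad : RadiallyUnbounded K F β) (α : ℝ) :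
    ∃ R : ℝ, ∀ u : BV T d, objective K F β u ≤ α → u.norm ≤ R := by
  by_contra! h
  choose u hu hR using fun k : ℕ => h k
  have h1 := hrad u (tendsto_atTop_mono (fun k => (hR k).le) tendsto_natCast_atTop_atTop)
  obtain ⟨k, hk⟩ := (h1.eventually_gt_atTop α).exists
  exact absurd (hu k) (not_le.2 hk)

/-- The sublevel sets of the objective in `L²`. -/
def sublevel (K : Lp (Vec d) 2 (leb T) →L[ℝ] Y) (F : Y → ℝ) (β α : ℝ) :
    Set (Lp (Vec d) 2 (leb T)) :=
  {v | ∃ q : Meas T d, IsDistribDeriv v q ∧ F (K v) + β * ‖q‖ ≤ α}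

theorem convex_sublevel (hF : ConvexOn ℝ univ F) (hβ : 0 < β) (α : ℝ) :
    Convex ℝ (sublevel K F β α) := by
  rintro v ⟨q, hq, hvq⟩ w ⟨r, hr, hwr⟩ a b ha hb hab
  refine ⟨a • q + b • r, hq.combo hr a b, ?_⟩
  have h1 : F (K (a • v + b • w)) ≤ a * F (K v) + b * F (K w) := by
    rw [map_add, map_smul, map_smul]
    exact hF.2 (mem_univ _) (mem_univ _) ha hb hab
  have h2 : ‖a • q + b • r‖ ≤ a * ‖q‖ + b * ‖r‖ := by
    refine (norm_add_le (a • q) (b • r)).trans ?_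
    refine add_le_add ?_ ?_
    · exact (ContinuousLinearMap.opNorm_smul_le a q).trans_eq (by rw [Real.norm_of_nonneg ha])
    · exact (ContinuousLinearMap.opNorm_smul_le b r).trans_eq (by rw [Real.norm_of_nonneg hb])
  calc F (K (a • v + b • w)) + β * ‖a • q + b • r‖
      ≤ a * F (K v) + b * F (K w) + β * (a * ‖q‖ + b * ‖r‖) :=
        add_le_add h1 (mul_le_mul_of_nonneg_left h2 hβ.le)
    _ = a * (F (K v) + β * ‖q‖) + b * (F (K w) + β * ‖r‖) := by ring
    _ ≤ a * α + b * α :=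
        add_le_add (mul_le_mul_of_nonneg_left hvq ha) (mul_le_mul_of_nonneg_left hwr hb)
    _ = α := by rw [← add_mul, hab, one_mul]

/-- Along a convergent sequence the variation is at most `(α - F (K v)) / β`, which converges by
continuity; lower semicontinuity carries the bound to the limit. -/
theorem isClosed_sublevel (hF : Continuous F) (hβ : 0 < β) (α : ℝ) :
    IsClosed (sublevel K F β α) := by
  refine IsSeqClosed.isClosed fun v v₀ hv hlim => ?_
  choose q hq hvq using hv
  have hFt : Tendsto (fun k => (α - F (K (v k))) / β) atTop (𝓝 ((α - F (K v₀)) / β)) :=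
    (tendsto_const_nhds.sub (((hF.comp K.continuous).tendsto v₀).comp hlim)).div_const β
  obtain ⟨q₀, hq₀, hM⟩ := exists_isDistribDeriv_of_tendsto hlim hq (fun k => by
    rw [le_div_iff₀ hβ]
    linarith [hvq k]) hFt
  refine ⟨q₀, hq₀, ?_⟩
  rw [le_div_iff₀ hβ] at hM
  linarith

theorem exists_isMinimizer (hT : 0 < T) (hFconv : ConvexOn ℝ univ F) (hF : Continuous F)
    (hβ : 0 < β) (hrad : RadiallyUnbounded K F β) : ∃ u : BV T d, IsMinimizer K F β u := by
  -- Taking the infimum in `EReal` avoids proving beforehand that the objective is bounded below.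
  set S : Set EReal := range fun u : BV T d => (objective K F β u : EReal) with hS
  have hne : S.Nonempty :=
    ⟨_, BV.ofL2 _ _ ((IsDistribDeriv.const hT (0 : Vec d)).congr_ae (Lp.coeFn_zero _ _ _).symm),
      rfl⟩
  obtain ⟨α, hα, hlim, hαS⟩ := exists_seq_tendsto_sInf hne (OrderBot.bddBelow S)
  choose u hu using hαS
  have hanti : Antitone fun n => objective K F β (u n) := fun n m h => by
    have := hα h
    rw [← hu, ← hu] at this
    exact EReal.coe_le_coe_iff.1 this
  obtain ⟨R, hR⟩ := hrad.exists_bound (objective K F β (u 0))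
  obtain ⟨C, hC⟩ := BV.exists_norm_toL2_le hT d
  obtain ⟨v, hv⟩ := nonempty_iInter_of_convex
    (C := fun n => sublevel K F β (objective K F β (u n))) (R := |C| * R)
    (fun n m h v ⟨q, hq, hvq⟩ => ⟨q, hq, hvq.trans (hanti h)⟩)
    (fun n => ⟨(u n).toL2, (u n).deriv, (u n).isDistribDeriv_toL2, le_rfl⟩)
    (fun n => isClosed_sublevel hF hβ _) (fun n => convex_sublevel hFconv hβ _) (by
      rintro v ⟨q, hq, hvq⟩
      have h1 := hR (BV.ofL2 v q hq) (by rwa [objective_ofL2])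
      have h2 := hC (BV.ofL2 v q hq)
      rw [BV.toL2_ofL2] at h2
      have h3 : 0 ≤ (BV.ofL2 v q hq).norm := add_nonneg (norm_nonneg (BV.deriv _)) (norm_nonneg _)
      calc ‖v‖ ≤ C * (BV.ofL2 v q hq).norm := h2
        _ ≤ |C| * (BV.ofL2 v q hq).norm := mul_le_mul_of_nonneg_right (le_abs_self _) h3
        _ ≤ |C| * R := mul_le_mul_of_nonneg_left h1 (abs_nonneg _))
  rw [mem_iInter] at hv
  obtain ⟨q, hq, -⟩ := hv 0
  refine ⟨BV.ofL2 v q hq, fun w => ?_⟩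
  have h1 : ∀ n, (objective K F β (BV.ofL2 v q hq) : EReal) ≤ α n := fun n => by
    obtain ⟨r, hr, hvr⟩ := hv n
    rw [← hu, EReal.coe_le_coe_iff, objective_ofL2, hq.unique hr]
    exact hvr
  have h2 := (ge_of_tendsto' hlim h1).trans (sInf_le (⟨w, rfl⟩ : _ ∈ S))
  exact EReal.coe_le_coe_iff.1 h2

end Existence

/-! ### Step functions -/

section Steps

variable {T : ℝ} {d : ℕ}

/-- The map `c ↦ c χ_t` as a linear map. -/
def stepL (T t : ℝ) (d : ℕ) : Vec d →ₗ[ℝ] Lp (Vec d) 2 (leb T) where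
  toFun := stepL2 T t
  map_add' a b := by
    refine Lp.ext ?_
    filter_upwards [stepL2_coeFn (T := T) t (a + b), stepL2_coeFn (T := T) t a,
      stepL2_coeFn (T := T) t b, Lp.coeFn_add (stepL2 T t a) (stepL2 T t b)] with s h1 h2 h3 h4
    rw [h4, Pi.add_apply, h1, h2, h3]
    by_cases h : s ∈ Ioo t T <;> simp [h]
  map_smul' c a := by
    refine Lp.ext ?_
    filter_upwards [stepL2_coeFn (T := T) t (c • a), stepL2_coeFn (T := T) t a,
      Lp.coeFn_smul c (stepL2 T t a)] with s h1 h2 h3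
    rw [RingHom.id_apply, h3, Pi.smul_apply, h1, h2]
    by_cases h : s ∈ Ioo t T <;> simp [h]

theorem stepL_apply (t : ℝ) (c : Vec d) : stepL T t d c = stepL2 T t c := rfl

theorem isDistribDeriv_stepL (t : Ioo (0 : ℝ) T) (c : Vec d) :
    IsDistribDeriv (stepL T t d c) (dirac t c) :=
  (IsDistribDeriv.step t c).congr_ae (stepL2_coeFn _ _).symm

theorem isDistribDeriv_stepL_zero (hT : 0 < T) (c : Vec d) :
    IsDistribDeriv (stepL T 0 d c) (0 : Meas T d) :=
  (IsDistribDeriv.const hT c).congr_ae (by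
    filter_upwards [stepL2_zero_coeFn (T := T) c] with s hs
    exact hs.symm)

theorem isDistribDeriv_sum {ι : Type*} (A : Finset ι) (m : ι → ℝ)
    (v : ι → Lp (Vec d) 2 (leb T)) (q : ι → Meas T d) (h : ∀ i, IsDistribDeriv (v i) (q i)) :
    IsDistribDeriv (∑ i ∈ A, m i • v i : Lp (Vec d) 2 (leb T)) (∑ i ∈ A, m i • q i) := by
  classical
  induction A using Finset.induction_on with
  | empty =>
    intro φ
    rw [Finset.sum_empty, Finset.sum_empty, _root_.zero_apply, neg_zero]
    refine integral_eq_zero_of_ae ?_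
    filter_upwards [Lp.coeFn_zero (Vec d) 2 (leb T)] with s hs
    rw [hs]
    simp
  | insert i A hi ih =>
    rw [Finset.sum_insert hi, Finset.sum_insert hi]
    simpa only [one_smul] using (h i).combo ih (m i) 1

/-- A function whose derivative is a combination of Dirac measures is piecewise constant. -/
theorem exists_eq_sum_stepL (hT : 0 < T) {ι : Type*} [Fintype ι] {v : Lp (Vec d) 2 (leb T)}
    (t : ι → Ioo (0 : ℝ) T) (c : ι → Vec d) (m : ι → ℝ)
    (h : IsDistribDeriv v (∑ i, m i • dirac (t i) (c i))) :
    ∃ a : Vec d, v = ∑ i, m i • stepL T (t i) d (c i) + stepL T 0 d a := by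
  -- Removing the steps leaves a function with zero derivative, hence a constant.
  have h1 := h.combo (isDistribDeriv_sum Finset.univ m _ _
    fun i => isDistribDeriv_stepL (t i) (c i)) 1 (-1)
  have hq0 : ∀ q : Meas T d, (1 : ℝ) • q + (-1 : ℝ) • q = 0 := fun q => by
    ext φ
    simp
  rw [hq0, one_smul, neg_smul, one_smul, ← sub_eq_add_neg] at h1
  obtain ⟨a, ha⟩ := exists_ae_eq_const hT (Lp2_integrable _) h1
  refine ⟨a, ?_⟩
  rw [← sub_eq_iff_eq_add']
  refine Lp.ext ?_
  filter_upwards [ha, stepL2_zero_coeFn (T := T) a] with s h2 h3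
  rw [h2]
  exact h3.symm

/-- The representation of a piecewise constant function by its mean value and its jumps. -/
theorem BV.ae_eq_mean_add (hT : 0 < T) {ι : Type*} [Fintype ι] (u : BV T d)
    (t : ι → Ioo (0 : ℝ) T) (c : ι → Vec d) (m : ι → ℝ) (a : Vec d)
    (h : u.toL2 = ∑ i, m i • stepL T (t i) d (c i) + stepL T 0 d a) :
    ∀ᵐ s ∂(leb T), u.1 s = u.mean + ∑ i,
      ((Ioo (t i : ℝ) T).indicator (fun _ => (1 : ℝ)) s - (T - t i) / T) • m i • c i := by
  classical
  have hsum : ∀ A : Finset ι, ∀ᵐ s ∂(leb T),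
      (∑ i ∈ A, m i • stepL T (t i) d (c i) : Lp (Vec d) 2 (leb T)) s =
        ∑ i ∈ A, (Ioo (t i : ℝ) T).indicator (fun _ => (1 : ℝ)) s • m i • c i := by
    intro A
    induction A using Finset.induction_on with
    | empty =>
      filter_upwards [Lp.coeFn_zero (Vec d) 2 (leb T)] with s hs
      rw [Finset.sum_empty, Finset.sum_empty, hs, Pi.zero_apply]
    | insert i A hi ih =>
      rw [Finset.sum_insert hi]
      filter_upwards [ih, stepL2_coeFn (T := T) (t i : ℝ) (c i),
        Lp.coeFn_smul (m i) (stepL T (t i) d (c i)),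
        Lp.coeFn_add (m i • stepL T (t i) d (c i)) (∑ i ∈ A, m i • stepL T (t i) d (c i))]
        with s h1 h2 h3 h4
      rw [Finset.sum_insert hi, h4, Pi.add_apply, h1, h3, Pi.smul_apply, stepL_apply, h2]
      congr 1
      by_cases hs : s ∈ Ioo (t i : ℝ) T <;> simp [hs]
  have hu : ∀ᵐ s ∂(leb T), u.1 s =
      (∑ i, (Ioo (t i : ℝ) T).indicator (fun _ => (1 : ℝ)) s • m i • c i) + a := by
    filter_upwards [u.toL2_coeFn, hsum Finset.univ, stepL2_zero_coeFn (T := T) a,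
      Lp.coeFn_add (∑ i, m i • stepL T (t i) d (c i)) (stepL T 0 d a)] with s h1 h2 h3 h4
    rw [← h1, h, h4, Pi.add_apply, h2, stepL_apply, h3]
  have hi : ∀ i, Integrable ((Ioo (t i : ℝ) T).indicator fun _ => (1 : ℝ)) (leb T) := fun i =>
    (integrable_const _).indicator measurableSet_Ioo
  have hint : ∀ i, ∫ s in Ioo 0 T, (Ioo (t i : ℝ) T).indicator (fun _ => (1 : ℝ)) s = T - t i :=
    fun i => by
      rw [setIntegral_indicator measurableSet_Ioo,
        inter_eq_self_of_subset_right (Ioo_subset_Ioo_left (t i).2.1.le)]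
      simp [measureReal_def, (t i).2.2.le]
  have hmean : u.mean = (∑ i, ((T - t i) / T) • m i • c i) + a := by
    rw [BV.mean, integral_congr_ae hu, integral_add
      (integrable_finsetSum _ fun i _ => (hi i).smul_const _) (integrable_const _),
      integral_finsetSum _ fun i _ => (hi i).smul_const _, integral_const, leb_real_univ hT,
      smul_add, inv_smul_smul₀ hT.ne', Finset.smul_sum]
    congr 1
    refine Finset.sum_congr rfl fun i _ => ?_
    rw [integral_smul_const, hint, smul_smul, div_eq_inv_mul]
  filter_upwards [hu] with s hs
  rw [hs, hmean]
  simp only [sub_smul, Finset.sum_sub_distrib]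
  abel

theorem norm_dirac_le (t : Ioo (0 : ℝ) T) (c : Vec d) : ‖(dirac t c : Meas T d)‖ ≤ ‖c‖ :=
  LinearMap.mkContinuous_norm_le _ (norm_nonneg c) _

end Steps

/-! ### Optimality conditions and structure of minimizers -/

section Optimality

variable {T : ℝ} {d : ℕ} {Y : Type*} [NormedAddCommGroup Y] [InnerProductSpace ℝ Y]
  {K : Lp (Vec d) 2 (leb T) →L[ℝ] Y} {F : Y → ℝ} {β : ℝ} {u : BV T d}

theorem IsMinimizer.le (hu : IsMinimizer K F β u) {v : Lp (Vec d) 2 (leb T)} {q : Meas T d}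
    (hq : IsDistribDeriv v q) :
    F (K u.toL2) + β * ‖u.deriv‖ ≤ F (K v) + β * ‖q‖ := by
  have := hu (BV.ofL2 v q hq)
  rwa [objective_ofL2] at this

/-- All minimizers have the same image under `K`. -/
theorem IsMinimizer.map_toL2_eq (hF : StrictConvexOn ℝ univ F) (hβ : 0 < β)
    (hu : IsMinimizer K F β u) {w : BV T d} (hw : IsMinimizer K F β w) :
    K w.toL2 = K u.toL2 := by
  by_contra hne
  have hpos : (0 : ℝ) < 1 / 2 := by norm_num
  have h1 := hF.2 (mem_univ (K w.toL2)) (mem_univ (K u.toL2)) hne hpos hpos (by norm_num)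
  -- With different images the midpoint would have a strictly smaller objective.
  have hcombo := w.isDistribDeriv_toL2.combo u.isDistribDeriv_toL2 (1 / 2) (1 / 2)
  have h2 := hu.le hcombo
  have h3 : ‖(1 / 2 : ℝ) • w.deriv + (1 / 2 : ℝ) • u.deriv‖ ≤
      1 / 2 * ‖w.deriv‖ + 1 / 2 * ‖u.deriv‖ := by
    refine (norm_add_le ((1 / 2 : ℝ) • w.deriv) ((1 / 2 : ℝ) • u.deriv)).trans ?_
    refine add_le_add ?_ ?_
    · exact (ContinuousLinearMap.opNorm_smul_le _ _).trans_eq (by norm_num)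
    · exact (ContinuousLinearMap.opNorm_smul_le _ _).trans_eq (by norm_num)
  have h4 := mul_le_mul_of_nonneg_left h3 hβ.le
  have h5 := hw u
  rw [map_add, map_smul, map_smul] at h2
  simp only [objective, smul_eq_mul] at h1 h5
  linarith

theorem stepL_zero_eq_sum (a : Vec d) :
    stepL T 0 d a = ∑ l, a l • stepL T 0 d (EuclideanSpace.single l (1 : ℝ)) := by
  simp only [← map_smul, ← map_sum]
  congr 1
  ext i
  simp [Pi.single_apply]

/-- The amplitudes and the constant are determined by the image under `K`. -/
theorem sum_stepL_eq_of_map_eq {ι : Type*} [Fintype ι] (t : ι → ℝ) (c : ι → Vec d)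
    (hli : LinearIndependent ℝ (Sum.elim (fun i => K (stepL2 T (t i) (c i)))
      (fun l : Fin d => K (stepL2 T 0 (EuclideanSpace.single l (1 : ℝ))))))
    {m m' : ι → ℝ} {a a' : Vec d} {γ : ℝ}
    (h : K (∑ i, m i • stepL T (t i) d (γ • c i) + stepL T 0 d a) =
      K (∑ i, m' i • stepL T (t i) d (γ • c i) + stepL T 0 d a')) :
    ∑ i, m i • stepL T (t i) d (γ • c i) + stepL T 0 d a =
      ∑ i, m' i • stepL T (t i) d (γ • c i) + stepL T 0 d a' := by
  -- Expansion in the family assumed independent after applying `K`. Only the products `n i * γ`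
  -- occur, so `γ` may be zero.
  have hexp : ∀ (n : ι → ℝ) (b : Vec d), ∑ i, n i • stepL T (t i) d (γ • c i) + stepL T 0 d b =
      ∑ i, (n i * γ) • stepL2 T (t i) (c i) +
        ∑ l, b l • stepL2 T 0 (EuclideanSpace.single l (1 : ℝ)) := fun n b => by
    rw [stepL_zero_eq_sum b]
    simp only [map_smul, smul_smul, stepL_apply]
  rw [hexp, hexp] at h ⊢
  have hz := Fintype.linearIndependent_iff.1 hli
    (Sum.elim (fun i => m i * γ - m' i * γ) fun l => a l - a' l) (by
      rw [Fintype.sum_sum_type]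
      simp only [Sum.elim_inl, Sum.elim_inr, sub_smul, Finset.sum_sub_distrib]
      simp only [map_add, map_sum, map_smul] at h
      rw [sub_add_sub_comm, h, sub_self])
  have h1 : ∀ i, m i * γ = m' i * γ := fun i => sub_eq_zero.1 (hz (Sum.inl i))
  have h2 : ∀ l, a l = a' l := fun l => sub_eq_zero.1 (hz (Sum.inr l))
  simp only [h1, h2]

variable [CompleteSpace Y]

/-- The variational inequality satisfied by a minimizer. -/
theorem IsMinimizer.variational_inequality (hF : ContDiff ℝ 1 F)
    (hβ : 0 < β) (hu : IsMinimizer K F β u) {w : Lp (Vec d) 2 (leb T)} {r : Meas T d}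
    (hr : IsDistribDeriv w r) :
    0 ≤ ⟪w - u.toL2, ContinuousLinearMap.adjoint K (∇ F (K u.toL2))⟫ +
      β * (‖r‖ - ‖u.deriv‖) := by
  set v := u.toL2 with hv
  rw [ContinuousLinearMap.adjoint_inner_right]
  have hline : HasDerivAt (fun s : ℝ => K v + s • K (w - v)) (K (w - v)) 0 := by
    simpa using ((hasDerivAt_id (0 : ℝ)).smul_const (K (w - v))).const_add (K v)
  have hgrad : HasFDerivAt F (InnerProductSpace.toDual ℝ Y (∇ F (K v)))
      (K v + (0 : ℝ) • K (w - v)) := by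
    rw [zero_smul, add_zero]
    exact ((hF.differentiable (by simp)) (K v)).hasGradientAt.hasFDerivAt
  -- Along the segment the variation is replaced by its affine upper bound from convexity. The
  -- resulting function is differentiable at zero and, by minimality, has nonnegative difference
  -- quotients from the right.
  have hder := (hgrad.comp_hasDerivAt (0 : ℝ) hline).add
    ((hasDerivAt_id (0 : ℝ)).mul_const (β * (‖r‖ - ‖u.deriv‖)))
  have hlim := hder.tendsto_slope_zero_right
  rw [InnerProductSpace.toDual_apply_apply, one_mul, real_inner_comm] at hlim
  refine ge_of_tendsto hlim ?_
  filter_upwards [Ioo_mem_nhdsGT (zero_lt_one' ℝ)] with s hs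
  have h1 := hu.le (u.isDistribDeriv_toL2.combo hr (1 - s) s)
  have h2 : ‖(1 - s) • u.deriv + s • r‖ ≤ (1 - s) * ‖u.deriv‖ + s * ‖r‖ := by
    refine (norm_add_le ((1 - s) • u.deriv) (s • r)).trans (add_le_add ?_ ?_)
    · exact (ContinuousLinearMap.opNorm_smul_le _ _).trans_eq
        (by rw [Real.norm_of_nonneg (by linarith [hs.2])])
    · exact (ContinuousLinearMap.opNorm_smul_le _ _).trans_eq (by rw [Real.norm_of_nonneg hs.1.le])
  have h3 := mul_le_mul_of_nonneg_left h2 hβ.le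
  have h4 : K v + s • K (w - v) = K ((1 - s) • v + s • w) := by
    simp only [map_add, map_smul, map_sub]
    module
  simp only [Pi.add_apply, Function.comp, zero_add, zero_smul, add_zero, id, zero_mul, smul_eq_mul,
    h4]
  refine mul_nonneg (inv_nonneg.2 hs.1.le) ?_
  rw [← hv] at h1
  nlinarith

theorem supNorm_eq {p : C0 T d} {f : ℝ → Vec d} (h : ∀ s : Ioo (0 : ℝ) T, p s = f s) :
    supNorm T f = ‖p‖ := by
  rw [← ZeroAtInftyContinuousMap.norm_toBCF_eq_norm, BoundedContinuousFunction.norm_eq_iSup_norm,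
    supNorm]
  exact iSup_congr fun s => by rw [← h]; rfl

/-- The first order conditions satisfied by a minimizer. -/
theorem IsMinimizer.exists_dual (hT : 0 < T) (hF : ContDiff ℝ 1 F)
    (hβ : 0 < β) (hu : IsMinimizer K F β u) :
    ∃ p : C0 T d, (∀ s : Ioo (0 : ℝ) T, p s = dualVar K F u s) ∧ (∀ s, ‖p s‖ ≤ β) ∧
      u.deriv p = β * ‖u.deriv‖ := by
  set g := ContinuousLinearMap.adjoint K (∇ F (K u.toL2)) with hg
  have hvi := fun (w : Lp (Vec d) 2 (leb T)) (r : Meas T d) (hr : IsDistribDeriv w r) =>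
    hu.variational_inequality hF hβ hr
  have hcombo := fun {w : Lp (Vec d) 2 (leb T)} {r : Meas T d} (hr : IsDistribDeriv w r) =>
    u.isDistribDeriv_toL2.combo hr
  have hg0 : ∫ s in Ioo 0 T, g s = 0 := by
    -- Subtracting the constant `∫ g` from `u` leaves the variation unchanged and gives `0 ≤ -‖∫
    -- g‖²`.
    have h := hvi _ _ (hcombo (isDistribDeriv_stepL_zero hT (∫ s in Ioo 0 T, g s)) 1 (-1))
    rw [one_smul, one_smul, smul_zero, add_zero, sub_self, mul_zero, add_zero, add_sub_cancel_left,
      inner_smul_left, stepL_apply, inner_stepL2_zero, real_inner_self_eq_norm_sq] at h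
    simp only [map_neg, map_one, neg_mul, one_mul] at h
    have : ‖∫ s in Ioo 0 T, g s‖ ^ 2 = 0 := le_antisymm (by linarith) (sq_nonneg _)
    exact norm_eq_zero.1 (pow_eq_zero_iff two_ne_zero |>.1 this)
  obtain ⟨p, hp⟩ := exists_primitiveC0 hT g hg0
  have hvp : ∀ (w : Lp (Vec d) 2 (leb T)) (r : Meas T d), IsDistribDeriv w r →
      0 ≤ -r p + u.deriv p + β * (‖r‖ - ‖u.deriv‖) := fun w r hr => by
    have := hvi w r hr
    rwa [inner_sub_left, hr.inner_eq hT hg0 hp, u.isDistribDeriv_toL2.inner_eq hT hg0 hp,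
      sub_neg_eq_add] at this
  have heq : u.deriv p = β * ‖u.deriv‖ := by
    refine le_antisymm ?_ ?_
    -- The competitor `2u` gives one inequality, the competitor `0` below the other.
    · have h := hvp _ _ (hcombo u.isDistribDeriv_toL2 1 1)
      have h2 : ‖(1 : ℝ) • u.deriv + (1 : ℝ) • u.deriv‖ ≤ ‖u.deriv‖ + ‖u.deriv‖ := by
        rw [one_smul]
        exact norm_add_le u.deriv u.deriv
      have h3 := mul_le_mul_of_nonneg_left h2 hβ.le
      rw [one_smul] at h h3
      rw [_root_.add_apply] at h
      linarith
    · have h := hvp _ _ (isDistribDeriv_stepL_zero hT 0)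
      rw [_root_.zero_apply, ContinuousLinearMap.opNorm_zero] at h
      linarith
  refine ⟨p, hp, fun s => ?_, heq⟩
  -- The single step `p(s) χ_s` gives `‖p s‖² ≤ β * ‖p s‖`.
  have h := hvp _ _ (isDistribDeriv_stepL s (p s))
  rw [dirac_apply, real_inner_self_eq_norm_sq, heq] at h
  have h2 := mul_le_mul_of_nonneg_left (norm_dirac_le s (p s)) hβ.le
  rcases (norm_nonneg (p s)).eq_or_lt with h0 | h0
  · rw [← h0]; exact hβ.le
  · nlinarith

/-- The structure of a minimizer whose dual variable attains its bound in finitely many points. -/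
theorem IsMinimizer.exists_jumps (hT : 0 < T) (hF : ContDiff ℝ 1 F)
    (hβ : 0 < β) (hu : IsMinimizer K F β u) {ι : Type*} [Fintype ι]
    (t : ι → Ioo (0 : ℝ) T) (ht : Function.Injective t)
    (htr : range t = {s : Ioo (0 : ℝ) T | ‖dualVar K F u s‖ = supNorm T (dualVar K F u) ∧
      supNorm T (dualVar K F u) = β}) :
    ∃ (m : ι → ℝ) (a : Vec d), (∀ i, 0 ≤ m i) ∧
      u.deriv = ∑ i, m i • dirac (t i) (β⁻¹ • dualVar K F u (t i)) ∧
      u.toL2 = ∑ i, m i • stepL T (t i) d (β⁻¹ • dualVar K F u (t i)) + stepL T 0 d a := by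
  obtain ⟨p, hp, hpβ, hq⟩ := hu.exists_dual hT hF hβ
  have : LocallyCompactSpace (Ioo (0 : ℝ) T) := isOpen_Ioo.locallyCompactSpace
  -- Since `‖p‖ ≤ β` is known, a point with `‖p s‖ = β` already forces the supremum to be `β`.
  have hset : range t = {s | ‖p s‖ = β} := by
    rw [htr, supNorm_eq hp]
    ext s
    simp only [mem_ofPred_eq, ← hp]
    refine ⟨fun h => h.1.trans h.2, fun h => ?_⟩
    have h2 : ‖p‖ = β := le_antisymm (zeroAtInfty_norm_le hβ.le hpβ)
      (h ▸ norm_apply_le_norm p s)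
    exact ⟨h.trans h2.symm, h2⟩
  obtain ⟨m, hm, hrep⟩ := exists_sum_inner_of_attains hβ u.deriv p hpβ hq t ht hset
  have hderiv : u.deriv = ∑ i, m i • dirac (t i) (β⁻¹ • dualVar K F u (t i)) := by
    ext φ
    rw [hrep, _root_.sum_apply]
    exact Finset.sum_congr rfl fun i _ => by rw [hp]; rfl
  obtain ⟨a, ha⟩ := exists_eq_sum_stepL hT t _ m (hderiv ▸ u.isDistribDeriv_toL2)
  exact ⟨m, a, hm, hderiv, ha⟩

end Optimality

end BVJump

end

theorem mainTheorem5 (T : ℝ) (hT : 0 < T) (d : ℕ)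
    {Y : Type*} [NormedAddCommGroup Y] [InnerProductSpace ℝ Y] [CompleteSpace Y]
    (K : Lp (BVJump.Vec d) 2 (BVJump.leb T) →L[ℝ] Y)
    (F : Y → ℝ) (hFconv : StrictConvexOn ℝ univ F) (hFdiff : ContDiff ℝ 1 F)
    (β : ℝ) (hβ : 0 < β) (hrad : BVJump.RadiallyUnbounded K F β) :
    (∃ u : BVJump.BV T d, BVJump.IsMinimizer K F β u) ∧
    ∀ (u : BVJump.BV T d), BVJump.IsMinimizer K F β u →
    ∀ (N : ℕ) (t : Fin N → Ioo (0 : ℝ) T),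
      range t = {s : Ioo (0 : ℝ) T |
        ‖BVJump.dualVar K F u s‖ = BVJump.supNorm T (BVJump.dualVar K F u) ∧
        BVJump.supNorm T (BVJump.dualVar K F u) = β} →
      LinearIndependent ℝ (Sum.elim
        (fun i : Fin N => K (BVJump.stepL2 T (t i) (BVJump.dualVar K F u (t i))))
        (fun l : Fin d => K (BVJump.stepL2 T 0 (EuclideanSpace.single l (1 : ℝ))))) →
      (∀ v : BVJump.BV T d, BVJump.IsMinimizer K F β v → v = u) ∧
      ∃ m : Fin N → ℝ, (∀ i, 0 ≤ m i) ∧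
        u.deriv = ∑ i, m i • BVJump.dirac (t i) (β⁻¹ • BVJump.dualVar K F u (t i)) ∧
        ∀ᵐ s ∂(BVJump.leb T), u.1 s = u.mean + ∑ i,
          ((Ioo (t i : ℝ) T).indicator (fun _ => (1 : ℝ)) s - (T - t i) / T) •
            m i • β⁻¹ • BVJump.dualVar K F u (t i) := by
  refine ⟨BVJump.exists_isMinimizer hT hFconv.convexOn hFdiff.continuous hβ hrad, ?_⟩
  intro u hu N t htr hli
  -- A repeated point would repeat a vector of the independent family.
  have ht : Function.Injective t := fun i j hij => by
    have h : (Sum.inl i : Fin N ⊕ Fin d) = Sum.inl j := hli.injective (by simp [hij])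
    exact Sum.inl_injective h
  obtain ⟨m, a, hm, hderiv, hrep⟩ := hu.exists_jumps hT hFdiff hβ t ht htr
  refine ⟨fun v hv => ?_, m, hm, hderiv, u.ae_eq_mean_add hT t _ m a hrep⟩
  have hK := hu.map_toL2_eq hFconv hβ hv
  -- The dual variable depends on the minimizer only through its image under `K`, so `v` has the
  -- same possible jump points and directions as `u`.
  have hdual : BVJump.dualVar K F v = BVJump.dualVar K F u := by
    funext s
    rw [BVJump.dualVar, BVJump.dualVar, hK]
  obtain ⟨m', a', -, -, hrep'⟩ := hv.exists_jumps hT hFdiff hβ t ht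
    (by rw [hdual]; exact htr)
  rw [hdual] at hrep'
  refine BVJump.BV.ext_toL2 ?_
  rw [hrep, hrep'] at hK ⊢
  exact BVJump.sum_stepL_eq_of_map_eq (fun i => (t i : ℝ)) _ hli hK
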